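/- **Setting.** Let $n\in\mathbb N$. For $X=\mathbb R^n$ or $X=T\mathbb R^n=\mathbb R^n\times\mathbb R^n$ (with the Euclidean distances), $\mathcal P(X)$ is the set of Borel probability measures on $X$, $\mathcal P_c(X)$ the subset of those with compact support, and $W^X(\mu,\nu)=\inf_\tau\int_{X\times X} d(x,y)\,d\tau(x,y)$, the infimum being over the probability measures $\tau$ on $X\times X$ with marginals $\mu$ and $\nu$; $W=W^{\mathbb R^n}$. A *probability vector field* is a map $V:\mathcal P(\mathbb R^n)\to\mathcal P(T\mathbb R^n)$ with $\pi_1\#V[\mu]=\mu$ for all $\mu$, where $\pi_1(x,v)=x$. Consider the conditions - (H1) with constant $C>0$: for all $\mu\in\mathcal P_c(\mathbb R^n)$, $\ \sup_{(x,v)\in \mathrm{Supp}(V[\mu])}|v|\le C\,\bigl(1+\sup_{x\in \mathrm{Supp}(\mu)}|x|\bigr)$; - (H2): the restriction of $V$ to $\mathcal P_c(\mathbb R^n)$ is continuous for the metrics $W^{\mathbb R^n}$ and $W^{T\mathbb R^n}$. *Solutions.* A (weak) solution on $[0,T]$ of the Cauchy problem $\dot\mu=V[\mu]$, $\mu(0)=\mu_0$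 is a map $\mu:[0,T]\to\mathcal P(\mathbb R^n)$ with $\mu(0)=\mu_0$ such that, for every $f\in C_c^\infty(\mathbb R^n)$: the integral $I_f(s)=\int_{T\mathbb R^n}\nabla f(x)\cdot v\;dV[\mu(s)](x,v)$ is defined for almost every $s\in[0,T]$; $I_f\in L^1([0,T])$; the map $t\mapsto\int f\,d\mu(t)$ is absolutely continuous on $[0,T]$; and $\frac{d}{dt}\int f\,d\mu(t)=I_f(t)$ for almost every $t\in[0,T]$. *Lattice Approximate Solutions (LAS).* For $N\ge1$ let $x_i$ be the points of $(\mathbb Z^n/N^2)\cap[-N,N]^n$ and $v_j$ the points of $(\mathbb Z^n/N)\cap[-N,N]^n$, and let $Q=[0,\frac1{N^2})^n$, $Q'=[0,\frac1N)^n$. Put $m_{ij}(\mu)=V[\mu](\{(x_i,v): v\in v_j+Q'\})$. Given $\mu_0$, define $\mu^N_0=\sum_i\mu_0(x_i+Q)\,\delta_{x_i}$, $\ \mu^N_{\ell+1}=\sum_{i,j}m_{ij}(\mu^N_\ell)\,\delta_{x_i+v_j/N}$, and $\mu^N(\ell/N+t)=\sum_{i,j}m_{ij}(\mu^N_\ell)\,\delta_{x_i+t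 v_j}$ for $0\le t<1/N$ and $\ell\in\mathbb N$. (For small $N$ the truncation to $[-N,N]^n$ may lose mass. When $\mu^N_\ell$ is not a probability measure, $m_{ij}(\mu^N_\ell)$ is taken to be $0$. The distance $W$ to a measure that is not a probability measure is $+\infty$.) **Theorem 3.1.** Let $V$ be a probability vector field satisfying (H1) with constant $C>0$, and (H2). Then for every $T>0$ and $\mu_0\in\mathcal P_c(\mathbb R^n)$ there exists a solution $\mu:[0,T]\to\mathcal P_c(\mathbb R^n)$ of the Cauchy problem $\dot\mu=V[\mu]$, $\mu(0)=\mu_0$, which is a uniform-in-time limit of LASs for the Wasserstein metric along a subsequence: there are $N_1<N_2<\cdots$ with $$\lim_{k\to\infty}\ \sup_{t\in[0,T]}W\bigl(\mu^{N_k}(t),\mu(t)\bigr)=0 .$$ Moreover, for every $R$ such that $\mathrm{Supp}(\mu_0)$ is contained in the closed ball of radius $R$ centered at the origin, $$W(\mu(t),\mu(s))\le C\,e^{CT}(R+1)\,|t-s|\qquad\text{for all } s,t\in[0,T].$$ -/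

import Mathlib

open MeasureTheory Filter Set
open scoped ENNReal Topology ContDiff

namespace MDE

/-! ### Wasserstein distance -/

section Wasserstein

variable {X : Type*} [PseudoEMetricSpace X] [MeasurableSpace X]

/-- The transference plans from `μ` to `ν`: probability measures on `X × X` with marginals
`μ` and `ν`. (The set is empty if `μ` or `ν` is not a probability measure.) -/
def transferencePlans (μ ν : Measure X) : Set (Measure (X × X)) :=
  {τ | IsProbabilityMeasure τ ∧ τ.map Prod.fst = μ ∧ τ.map Prod.snd = ν}

/-- The transportation cost `J(τ) = ∫ d(x,y) dτ(x,y)`. -/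
noncomputable def transportCost (τ : Measure (X × X)) : ℝ≥0∞ :=
  ∫⁻ p, edist p.1 p.2 ∂τ

/-- The Wasserstein distance `W(μ, ν) = inf_τ J(τ)` over the transference plans `τ` from `μ` to
`ν`, with values in `[0, ∞]` (it is `∞` if there are no plans). -/
noncomputable def wasserstein (μ ν : Measure X) : ℝ≥0∞ :=
  ⨅ τ ∈ transferencePlans μ ν, transportCost τ

end Wasserstein

/-! ### Probability vector fields -/

/-- The space `ℝⁿ` with the Euclidean norm. -/
abbrev Space (n : ℕ) : Type := EuclideanSpace ℝ (Fin n)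

/-- The tangent bundle `Tℝⁿ = ℝⁿ × ℝⁿ` with the Euclidean norm of `ℝ²ⁿ`; a point is a pair
`(x, v)`, with `x = p.fst` and `v = p.snd`. -/
abbrev TSpace (n : ℕ) : Type := WithLp 2 (Space n × Space n)

/-- `μ` belongs to `𝒫_c`: it has compact support. -/
def HasCompactSupp {X : Type*} [TopologicalSpace X] [MeasurableSpace X]
    (μ : ProbabilityMeasure X) : Prop :=
  IsCompact (μ : Measure X).support

/-- A probability vector field: a map `V : 𝒫(ℝⁿ) → 𝒫(Tℝⁿ)` with `π₁ # V[μ] = μ`. -/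
structure PVF (n : ℕ) where
  toFun : ProbabilityMeasure (Space n) → ProbabilityMeasure (TSpace n)
  map_fst : ∀ μ : ProbabilityMeasure (Space n),
    (toFun μ : Measure (TSpace n)).map (fun p => p.fst) = (μ : Measure (Space n))

instance (n : ℕ) : CoeFun (PVF n)
    (fun _ => ProbabilityMeasure (Space n) → ProbabilityMeasure (TSpace n)) :=
  ⟨PVF.toFun⟩

/-- `V` is support sublinear with constant `C`: for every compactly supported `μ`,
`sup {|v| : (x,v) ∈ Supp V[μ]} ≤ C (1 + sup {|x| : x ∈ Supp μ})`. Suprema are taken in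
`[0, ∞]`. -/
def PVF.SupportSublinear {n : ℕ} (V : PVF n) (C : ℝ) : Prop :=
  ∀ μ : ProbabilityMeasure (Space n), HasCompactSupp μ →
    (⨆ p ∈ (V μ : Measure (TSpace n)).support, ‖p.snd‖ₑ) ≤
      ENNReal.ofReal C * (1 + ⨆ x ∈ (μ : Measure (Space n)).support, ‖x‖ₑ)

/-- The restriction of `V` to compactly supported measures is continuous for the Wasserstein
metrics of `ℝⁿ` and `Tℝⁿ`. -/
def PVF.WassersteinContinuous {n : ℕ} (V : PVF n) : Prop :=
  ∀ μ : ProbabilityMeasure (Space n), HasCompactSupp μ →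
    ∀ ε : ℝ≥0∞, 0 < ε → ∃ δ : ℝ≥0∞, 0 < δ ∧
      ∀ ν : ProbabilityMeasure (Space n), HasCompactSupp ν →
        wasserstein (ν : Measure (Space n)) (μ : Measure (Space n)) < δ →
        wasserstein (V ν : Measure (TSpace n)) (V μ : Measure (TSpace n)) < ε

/-! ### Weak solutions -/

/-- The function `(x,v) ↦ ∇f(x) · v` on `Tℝⁿ`. -/
noncomputable def gradPairing {n : ℕ} (f : Space n → ℝ) (p : TSpace n) : ℝ :=
  inner ℝ (gradient f p.fst) p.snd

/-- `μ` (only its values on `[0,T]` matter) is a weak solution on `[0,T]` of the Cauchy problem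
`μ̇ = V[μ]`, `μ(0) = μ₀`. -/
def IsSolution {n : ℕ} (V : PVF n) (T : ℝ) (μ₀ : ProbabilityMeasure (Space n))
    (μ : ℝ → ProbabilityMeasure (Space n)) : Prop :=
  μ 0 = μ₀ ∧
  ∀ f : Space n → ℝ, ContDiff ℝ ∞ f → HasCompactSupport f →
    (∀ᵐ s ∂(volume.restrict (Icc 0 T)),
      Integrable (gradPairing f) (V (μ s) : Measure (TSpace n))) ∧
    IntegrableOn (fun s => ∫ p, gradPairing f p ∂(V (μ s) : Measure (TSpace n))) (Icc 0 T) ∧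
    AbsolutelyContinuousOnInterval (fun t => ∫ x, f x ∂(μ t : Measure (Space n))) 0 T ∧
    (∀ᵐ t ∂(volume.restrict (Icc 0 T)),
      HasDerivAt (fun t' => ∫ x, f x ∂(μ t' : Measure (Space n)))
        (∫ p, gradPairing f p ∂(V (μ t) : Measure (TSpace n))) t)

/-! ### Lattice approximate solutions -/

/-- The point `h z` of the lattice `h ℤⁿ`. -/
noncomputable def latticePoint {n : ℕ} (h : ℝ) (z : Fin n → ℤ) : Space n :=
  WithLp.toLp 2 (fun k => h * (z k : ℝ))

/-- The half-open cube `h z + [0, h)ⁿ`. -/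
def latticeCell {n : ℕ} (h : ℝ) (z : Fin n → ℤ) : Set (Space n) :=
  {y | ∀ k, h * (z k : ℝ) ≤ y k ∧ y k < h * (z k : ℝ) + h}

/-- Time step size, which is also the velocity step size: `1/N`. -/
noncomputable def timeStep (N : ℕ) : ℝ := 1 / (N : ℝ)

/-- Space step size: `1/N²`. -/
noncomputable def spaceStep (N : ℕ) : ℝ := 1 / (N : ℝ) ^ 2

/-- The indices `z` of the `(2N³+1)ⁿ` points `z/N²` of `ℤⁿ/N² ∩ [-N,N]ⁿ`. -/
noncomputable def spaceIndices (n N : ℕ) : Finset (Fin n → ℤ) :=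
  Fintype.piFinset fun _ => Finset.Icc (-((N : ℤ) ^ 3)) ((N : ℤ) ^ 3)

/-- The indices `z` of the `(2N²+1)ⁿ` points `z/N` of `ℤⁿ/N ∩ [-N,N]ⁿ`. -/
noncomputable def velIndices (n N : ℕ) : Finset (Fin n → ℤ) :=
  Fintype.piFinset fun _ => Finset.Icc (-((N : ℤ) ^ 2)) ((N : ℤ) ^ 2)

/-- The space discretization `𝒜ˣ_N(μ) = ∑ᵢ μ(xᵢ + Q) δ_{xᵢ}`. -/
noncomputable def discSpace {n : ℕ} (N : ℕ) (μ : Measure (Space n)) : Measure (Space n) :=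
  ∑ i ∈ spaceIndices n N,
    μ (latticeCell (spaceStep N) i) • Measure.dirac (latticePoint (spaceStep N) i)

open Classical in
/-- `V[m]` for a measure `m`; the value is `0` if `m` is not a probability measure. -/
noncomputable def PVF.onMeasure {n : ℕ} (V : PVF n) (m : Measure (Space n)) :
    Measure (TSpace n) :=
  if h : IsProbabilityMeasure m then (V ⟨m, h⟩ : Measure (TSpace n)) else 0

/-- The mass `mᵛᵢⱼ(V[m]) = V[m]({(xᵢ, v) : v ∈ vⱼ + Q'})`. -/
noncomputable def velMass {n : ℕ} (V : PVF n) (N : ℕ) (m : Measure (Space n))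
    (i j : Fin n → ℤ) : ℝ≥0∞ :=
  V.onMeasure m {p | p.fst = latticePoint (spaceStep N) i ∧ p.snd ∈ latticeCell (timeStep N) j}

/-- The measure `∑ᵢ ∑ⱼ mᵛᵢⱼ(V[m]) δ_{xᵢ + t vⱼ}`. -/
noncomputable def lasMove {n : ℕ} (V : PVF n) (N : ℕ) (m : Measure (Space n)) (t : ℝ) :
    Measure (Space n) :=
  ∑ i ∈ spaceIndices n N, ∑ j ∈ velIndices n N,
    velMass V N m i j •
      Measure.dirac (latticePoint (spaceStep N) i + t • latticePoint (timeStep N) j)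

/-- The lattice approximate solution at the time `ℓ/N`. -/
noncomputable def lasGrid {n : ℕ} (V : PVF n) (N : ℕ) (μ₀ : ProbabilityMeasure (Space n)) :
    ℕ → Measure (Space n)
  | 0 => discSpace N (μ₀ : Measure (Space n))
  | ℓ + 1 => lasMove V N (lasGrid V N μ₀ ℓ) (timeStep N)

/-- The lattice approximate solution `μᴺ` at the time `t ≥ 0`: with `ℓ = ⌊N t⌋` it is
`∑ᵢ ∑ⱼ mᵛᵢⱼ(V[μᴺ_ℓ]) δ_{xᵢ + (t - ℓ/N) vⱼ}`. -/
noncomputable def las {n : ℕ} (V : PVF n) (N : ℕ) (μ₀ : ProbabilityMeasure (Space n)) (t : ℝ) :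
    Measure (Space n) :=
  lasMove V N (lasGrid V N μ₀ ⌊(N : ℝ) * t⌋₊) (t - (⌊(N : ℝ) * t⌋₊ : ℝ) * timeStep N)

end MDE

namespace MDE

open scoped ProbabilityTheory

section Plans

variable {X : Type*} [PseudoEMetricSpace X] [MeasurableSpace X]

lemma wasserstein_le_transportCost {μ ν : Measure X} {τ : Measure (X × X)}
    (h : τ ∈ transferencePlans μ ν) : wasserstein μ ν ≤ transportCost τ :=
  iInf₂_le _ h

lemma exists_plan_of_wasserstein_lt {μ ν : Measure X} {c : ℝ≥0∞} (h : wasserstein μ ν < c) :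
    ∃ τ ∈ transferencePlans μ ν, transportCost τ < c := by
  simpa [wasserstein, iInf_lt_iff] using h

lemma wasserstein_comm_le (μ ν : Measure X) : wasserstein ν μ ≤ wasserstein μ ν := by
  refine le_iInf₂ fun τ hτ => ?_
  obtain ⟨h1, h2, h3⟩ := hτ
  have hmem : τ.map (MeasurableEquiv.prodComm : X × X ≃ᵐ X × X) ∈ transferencePlans ν μ := by
    refine ⟨Measure.isProbabilityMeasure_map (MeasurableEquiv.measurable _).aemeasurable, ?_, ?_⟩
    · rw [Measure.map_map measurable_fst (MeasurableEquiv.measurable _), ← h3]; rfl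
    · rw [Measure.map_map measurable_snd (MeasurableEquiv.measurable _), ← h2]; rfl
  refine (wasserstein_le_transportCost hmem).trans (le_of_eq ?_)
  rw [transportCost, lintegral_map_equiv]
  exact lintegral_congr fun p => edist_comm _ _

lemma wasserstein_comm (μ ν : Measure X) : wasserstein μ ν = wasserstein ν μ :=
  le_antisymm (wasserstein_comm_le ν μ) (wasserstein_comm_le μ ν)

/-- A plan may be chosen as the joint law of two maps. -/
lemma wasserstein_map_le {Y : Type*} [MeasurableSpace Y] [SecondCountableTopology X]
    [OpensMeasurableSpace X] (ν : Measure Y) [IsProbabilityMeasure ν] {f g : Y → X}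
    (hf : Measurable f) (hg : Measurable g) :
    wasserstein (ν.map f) (ν.map g) ≤ ∫⁻ y, edist (f y) (g y) ∂ν := by
  have hfg : Measurable fun y => (f y, g y) := hf.prodMk hg
  have hmem : ν.map (fun y => (f y, g y)) ∈ transferencePlans (ν.map f) (ν.map g) := by
    refine ⟨Measure.isProbabilityMeasure_map hfg.aemeasurable, ?_, ?_⟩
    · rw [Measure.map_map measurable_fst hfg]; rfl
    · rw [Measure.map_map measurable_snd hfg]; rfl
  refine (wasserstein_le_transportCost hmem).trans (le_of_eq ?_)
  rw [transportCost, lintegral_map measurable_edist hfg]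

lemma wasserstein_map_le_of_ae {Y : Type*} [MeasurableSpace Y] [SecondCountableTopology X]
    [OpensMeasurableSpace X] (ν : Measure Y) [IsProbabilityMeasure ν] {f g : Y → X}
    (hf : Measurable f) (hg : Measurable g) {c : ℝ≥0∞} (h : ∀ᵐ y ∂ν, edist (f y) (g y) ≤ c) :
    wasserstein (ν.map f) (ν.map g) ≤ c :=
  (wasserstein_map_le ν hf hg).trans <|
    (lintegral_mono_ae h).trans (by simp)

/-- Gluing of two plans along the common marginal. -/
lemma wasserstein_triangle [SecondCountableTopology X] [BorelSpace X] [StandardBorelSpace X]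
    (μ ν ρ : Measure X) : wasserstein μ ρ ≤ wasserstein μ ν + wasserstein ν ρ := by
  refine ENNReal.le_of_forall_pos_le_add fun ε hε hfin => ?_
  obtain ⟨h1fin, h2fin⟩ := ENNReal.add_lt_top.1 hfin
  have hε2 : (ε / 2 : ℝ≥0∞) ≠ 0 := by simpa using hε.ne'
  obtain ⟨τ₁, ⟨i1, l1, r1⟩, c1⟩ :=
    exists_plan_of_wasserstein_lt (ENNReal.lt_add_right h1fin.ne hε2)
  obtain ⟨τ₂, ⟨i2, l2, r2⟩, c2⟩ :=
    exists_plan_of_wasserstein_lt (ENNReal.lt_add_right h2fin.ne hε2)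
  have hne : Nonempty X := by
    obtain ⟨x⟩ := τ₁.nonempty_of_neZero
    exact ⟨x.1⟩
  set τ₁' : Measure (X × X) := τ₁.map Prod.swap with hτ₁'
  have i1' : IsProbabilityMeasure τ₁' :=
    Measure.isProbabilityMeasure_map measurable_swap.aemeasurable
  have f1 : τ₁'.fst = ν := by
    rw [Measure.fst, hτ₁', Measure.map_map measurable_fst measurable_swap, ← r1]; rfl
  have f2 : τ₂.fst = ν := l2
  have iν : IsProbabilityMeasure ν := by rw [← f2]; infer_instance
  set κ₁ := τ₁'.condKernel
  set κ₂ := τ₂.condKernel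
  have d1 : ν ⊗ₘ κ₁ = τ₁' := by rw [← f1]; exact τ₁'.disintegrate κ₁
  have d2 : ν ⊗ₘ κ₂ = τ₂ := by rw [← f2]; exact τ₂.disintegrate κ₂
  set σ : Measure (X × X × X) := ν ⊗ₘ (κ₁ ×ₖ κ₂) with hσ
  have m1 : σ.map (Prod.map id Prod.fst) = τ₁' := by
    rw [hσ, ← Measure.compProd_map measurable_fst, ← ProbabilityTheory.Kernel.fst_eq,
      ProbabilityTheory.Kernel.fst_prod, d1]
  have m2 : σ.map (Prod.map id Prod.snd) = τ₂ := by
    rw [hσ, ← Measure.compProd_map measurable_snd, ← ProbabilityTheory.Kernel.snd_eq,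
      ProbabilityTheory.Kernel.snd_prod, d2]
  have mm1 : Measurable (Prod.map id Prod.fst : X × X × X → X × X) := by fun_prop
  have mm2 : Measurable (Prod.map id Prod.snd : X × X × X → X × X) := by fun_prop
  have hmem : σ.snd ∈ transferencePlans μ ρ := by
    refine ⟨inferInstance, ?_, ?_⟩
    · rw [Measure.snd, Measure.map_map measurable_fst measurable_snd, ← l1]
      have : τ₁ = τ₁'.map Prod.swap := by
        rw [hτ₁', Measure.map_map measurable_swap measurable_swap]; simp
      rw [this, ← m1, Measure.map_map measurable_swap mm1,
        Measure.map_map measurable_fst (measurable_swap.comp mm1)]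
      rfl
    · rw [Measure.snd, Measure.map_map measurable_snd measurable_snd, ← r2, ← m2,
        Measure.map_map measurable_snd mm2]
      rfl
  have e1 : transportCost τ₁ = ∫⁻ q, edist q.2.1 q.1 ∂σ := by
    have : transportCost τ₁ = ∫⁻ p, edist p.2 p.1 ∂τ₁' := by
      rw [hτ₁', lintegral_map (by fun_prop) measurable_swap]; rfl
    rw [this, ← m1, lintegral_map (by fun_prop) mm1]; rfl
  have e2 : transportCost τ₂ = ∫⁻ q, edist q.1 q.2.2 ∂σ := by
    rw [transportCost, ← m2, lintegral_map (by fun_prop) mm2]; rfl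
  have hcost : transportCost σ.snd ≤ transportCost τ₁ + transportCost τ₂ := by
    rw [e1, e2, ← lintegral_add_left (by fun_prop), transportCost, Measure.snd,
      lintegral_map (by fun_prop) measurable_snd]
    exact lintegral_mono fun q => edist_triangle _ _ _
  calc wasserstein μ ρ ≤ transportCost σ.snd := wasserstein_le_transportCost hmem
    _ ≤ transportCost τ₁ + transportCost τ₂ := hcost
    _ ≤ (wasserstein μ ν + ε / 2) + (wasserstein ν ρ + ε / 2) := add_le_add c1.le c2.le
    _ = wasserstein μ ν + wasserstein ν ρ + (ε / 2 + ε / 2) := by ring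
    _ = wasserstein μ ν + wasserstein ν ρ + ε := by rw [ENNReal.add_halves]

/-- The integrals of a Lipschitz function are controlled by the Wasserstein distance. -/
lemma enorm_integral_sub_le_wasserstein {E : Type*} [NormedAddCommGroup E] [NormedSpace ℝ E]
    {μ ν : Measure X} {g : X → E}
    (hμ : Integrable g μ) (hν : Integrable g ν) {K : ℝ≥0∞} (hK : K ≠ 0) (hK' : K ≠ ⊤)
    (h : ∀ᵐ p ∂μ, ∀ q, ‖g p - g q‖ₑ ≤ K * edist p q) :
    ‖∫ p, g p ∂μ - ∫ q, g q ∂ν‖ₑ ≤ K * wasserstein μ ν := by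
  rw [wasserstein, ENNReal.mul_iInf_of_ne hK hK']
  refine le_iInf fun τ => ?_
  rw [ENNReal.mul_iInf_of_ne hK hK']
  refine le_iInf fun ⟨i, l, r⟩ => ?_
  subst l
  subst r
  have g1 : Integrable (fun p : X × X => g p.1) τ := hμ.comp_measurable measurable_fst
  have g2 : Integrable (fun p : X × X => g p.2) τ := hν.comp_measurable measurable_snd
  rw [integral_map measurable_fst.aemeasurable hμ.1, integral_map measurable_snd.aemeasurable hν.1,
    ← integral_sub g1 g2, transportCost, ← lintegral_const_mul' _ _ hK']
  refine (enorm_integral_le_lintegral_enorm _).trans (lintegral_mono_ae ?_)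
  filter_upwards [ae_of_ae_map measurable_fst.aemeasurable h] with p hp using hp p.2

end Plans

section Coupling

variable {X : Type*} [PseudoEMetricSpace X] [MeasurableSpace X]

/-- Two measures that are sums of pieces lying pairwise at distance at most `ε` are at distance at
most `ε` plus the diameter times the excess of the masses of the pieces. -/
lemma wasserstein_sum_le {ι : Type*} [Fintype ι] (μ ν : ι → Measure X)
    [hμ : IsProbabilityMeasure (∑ i, μ i)] [hν : IsProbabilityMeasure (∑ i, ν i)]
    {ε D : ℝ≥0∞} (hε : ∀ i, ∀ᵐ p ∂(μ i).prod (ν i), edist p.1 p.2 ≤ ε)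
    (hD : ∀ᵐ p ∂(∑ i, μ i).prod (∑ i, ν i), edist p.1 p.2 ≤ D) :
    wasserstein (∑ i, μ i) (∑ i, ν i) ≤ ε + D * ∑ i, (μ i univ - ν i univ) := by
  have hfμ : ∀ i, IsFiniteMeasure (μ i) := fun i =>
    ⟨(Measure.le_iff'.1 (Finset.single_le_sum (f := μ) (fun _ _ => bot_le)
      (Finset.mem_univ i)) univ).trans_lt (measure_lt_top _ _)⟩
  have hfν : ∀ i, IsFiniteMeasure (ν i) := fun i =>
    ⟨(Measure.le_iff'.1 (Finset.single_le_sum (f := ν) (fun _ _ => bot_le)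
      (Finset.mem_univ i)) univ).trans_lt (measure_lt_top _ _)⟩
  set a : ι → ℝ≥0∞ := fun i => μ i univ with ha
  set b : ι → ℝ≥0∞ := fun i => ν i univ with hb
  have ha1 : ∑ i, a i = 1 := by
    rw [← hμ.measure_univ, Measure.finsetSum_apply]
  have hb1 : ∑ i, b i = 1 := by
    rw [← hν.measure_univ, Measure.finsetSum_apply]
  have hat : ∀ i, a i ≠ ⊤ := fun i => measure_ne_top _ _
  have hbt : ∀ i, b i ≠ ⊤ := fun i => measure_ne_top _ _
  set c : ι → ℝ≥0∞ := fun i => min (a i) (b i) with hc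
  have hc1 : ∑ i, c i ≤ 1 := ha1 ▸ Finset.sum_le_sum fun i _ => min_le_left _ _
  have hmul : ∀ {x y : ℝ≥0∞}, x ≠ ⊤ → y ≤ x → y / x * x = y := fun {x y} hx hy => by
    rcases eq_or_ne x 0 with rfl | h0
    · simp [nonpos_iff_eq_zero.1 hy]
    · exact ENNReal.div_mul_cancel h0 hx
  set s : ℝ≥0∞ := 1 - ∑ i, c i with hs
  have hsplit : ∀ d : ι → ℝ≥0∞, (∀ i, c i ≤ d i) → ∑ i, d i = 1 → ∑ i, (d i - c i) = s := by
    intro d hd hd1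
    have : ∑ i, (d i - c i) + ∑ i, c i = 1 := by
      rw [← Finset.sum_add_distrib, ← hd1]
      exact Finset.sum_congr rfl fun i _ => tsub_add_cancel_of_le (hd i)
    exact ENNReal.eq_sub_of_add_eq (ne_top_of_le_ne_top ENNReal.one_ne_top hc1) this
  have hsa := hsplit a (fun i => min_le_left _ _) ha1
  have hsb := hsplit b (fun i => min_le_right _ _) hb1
  have hst : s ≠ ⊤ := ne_top_of_le_ne_top ENNReal.one_ne_top tsub_le_self
  have hle1 : ∀ {x y : ℝ≥0∞}, y ≤ x → y / x ≤ 1 := fun h =>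
    ENNReal.div_le_of_le_mul (by simpa using h)
  set μ' : Measure X := ∑ i, (1 - c i / a i) • μ i with hμ'
  set ν' : Measure X := ∑ i, (1 - c i / b i) • ν i with hν'
  have hμ'u : μ' univ = s := by
    rw [← hsa, hμ', Measure.finsetSum_apply]
    refine Finset.sum_congr rfl fun i _ => ?_
    change (1 - c i / a i) * a i = _
    rw [ENNReal.sub_mul (fun _ _ => hat i), one_mul, hmul (hat i) (min_le_left _ _)]
  have hν'u : ν' univ = s := by
    rw [← hsb, hν', Measure.finsetSum_apply]
    refine Finset.sum_congr rfl fun i _ => ?_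
    change (1 - c i / b i) * b i = _
    rw [ENNReal.sub_mul (fun _ _ => hbt i), one_mul, hmul (hbt i) (min_le_right _ _)]
  have fμ' : IsFiniteMeasure μ' := ⟨by rw [hμ'u]; exact hst.lt_top⟩
  have fν' : IsFiniteMeasure ν' := ⟨by rw [hν'u]; exact hst.lt_top⟩
  set w : ι → ℝ≥0∞ := fun i => c i / a i / b i with hw
  have hwb : ∀ i, w i * b i = c i / a i := fun i => by
    rcases eq_or_ne (b i) 0 with h0 | h0
    · simp [hc, h0]
    · exact ENNReal.div_mul_cancel h0 (hbt i)
  have hwa : ∀ i, w i * a i = c i / b i := fun i => by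
    rcases eq_or_ne (a i) 0 with h0 | h0
    · simp [hc, h0]
    · rw [hw]
      change c i / a i / b i * a i = _
      rw [ENNReal.div_right_comm, ENNReal.div_mul_cancel h0 (hat i)]
  set τ : Measure (X × X) := ∑ i, w i • (μ i).prod (ν i) + s⁻¹ • μ'.prod ν' with hτ
  have hfst : τ.map Prod.fst = ∑ i, μ i := by
    have hμ's : s⁻¹ • (s • μ') = μ' := by
      rcases eq_or_ne s 0 with h0 | h0
      · have : μ' = 0 := by rw [← Measure.measure_univ_eq_zero, hμ'u, h0]
        simp [this]
      · rw [smul_smul, ENNReal.inv_mul_cancel h0 hst, one_smul]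
    rw [hτ, Measure.map_add _ _ measurable_fst, Measure.map_finset_sum measurable_fst.aemeasurable,
      Measure.map_smul, Measure.map_fst_prod, hν'u, hμ's, hμ', ← Finset.sum_add_distrib]
    refine Finset.sum_congr rfl fun i _ => ?_
    rw [Measure.map_smul, Measure.map_fst_prod, smul_smul]
    change (w i * b i) • μ i + _ = _
    rw [hwb, ← add_smul, add_tsub_cancel_of_le (hle1 (min_le_left _ _)), one_smul]
  have hsnd : τ.map Prod.snd = ∑ i, ν i := by
    have hν's : s⁻¹ • (s • ν') = ν' := by
      rcases eq_or_ne s 0 with h0 | h0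
      · have : ν' = 0 := by rw [← Measure.measure_univ_eq_zero, hν'u, h0]
        simp [this]
      · rw [smul_smul, ENNReal.inv_mul_cancel h0 hst, one_smul]
    rw [hτ, Measure.map_add _ _ measurable_snd, Measure.map_finset_sum measurable_snd.aemeasurable,
      Measure.map_smul, Measure.map_snd_prod, hμ'u, hν's, hν', ← Finset.sum_add_distrib]
    refine Finset.sum_congr rfl fun i _ => ?_
    rw [Measure.map_smul, Measure.map_snd_prod, smul_smul]
    change (w i * a i) • ν i + _ = _
    rw [hwa, ← add_smul, add_tsub_cancel_of_le (hle1 (min_le_right _ _)), one_smul]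
  have hprob : IsProbabilityMeasure τ := by
    refine ⟨?_⟩
    have := hμ.measure_univ
    rwa [← hfst, Measure.map_apply measurable_fst MeasurableSet.univ, preimage_univ] at this
  refine (wasserstein_le_transportCost ⟨hprob, hfst, hsnd⟩).trans ?_
  have hs' : ∑ i, (a i - b i) = s := by
    rw [← hsa]
    refine Finset.sum_congr rfl fun i _ => ?_
    rcases le_total (a i) (b i) with h | h <;> simp [hc, h, tsub_eq_zero_of_le]
  have hDμν : ∫⁻ p, edist p.1 p.2 ∂μ'.prod ν' ≤ D * (s * s) := by
    have hle : ∀ (d : ι → ℝ≥0∞) (m : ι → Measure X), (∀ i, d i ≤ 1) →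
        ∑ i, d i • m i ≤ ∑ i, m i := fun d m hd => Finset.sum_le_sum fun i _ =>
      Measure.le_iff'.2 fun t => by simpa using mul_le_of_le_one_left bot_le (hd i)
    have hac : μ'.prod ν' ≪ (∑ i, μ i).prod (∑ i, ν i) :=
      (hle _ μ fun i => tsub_le_self).absolutelyContinuous.prod
        (hle _ ν fun i => tsub_le_self).absolutelyContinuous
    have : ∀ᵐ p ∂μ'.prod ν', edist p.1 p.2 ≤ D := hac.ae_le hD
    refine (lintegral_mono_ae this).trans (le_of_eq ?_)
    rw [lintegral_const, ← univ_prod_univ, Measure.prod_prod, hμ'u, hν'u]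
  have hεi : ∀ i, ∫⁻ p, edist p.1 p.2 ∂(μ i).prod (ν i) ≤ ε * (a i * b i) := fun i => by
    refine (lintegral_mono_ae (hε i)).trans (le_of_eq ?_)
    rw [lintegral_const, ← univ_prod_univ, Measure.prod_prod]
  rw [hs', transportCost, hτ, lintegral_add_measure, lintegral_finsetSum_measure]
  refine add_le_add ?_ ?_
  · calc ∑ i, ∫⁻ p, edist p.1 p.2 ∂(w i • (μ i).prod (ν i)) ≤ ∑ i, ε * c i := by
          refine Finset.sum_le_sum fun i _ => ?_
          rw [lintegral_smul_measure, smul_eq_mul]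
          calc w i * ∫⁻ p, edist p.1 p.2 ∂(μ i).prod (ν i) ≤ w i * (ε * (a i * b i)) := by
                gcongr; exact hεi i
            _ = ε * (w i * a i * b i) := by ring
            _ = ε * c i := by rw [hwa, hmul (hbt i) (min_le_right _ _)]
      _ = ε * ∑ i, c i := by rw [Finset.mul_sum]
      _ ≤ ε := mul_le_of_le_one_right bot_le hc1
  · rw [lintegral_smul_measure, smul_eq_mul]
    calc s⁻¹ * ∫⁻ p, edist p.1 p.2 ∂μ'.prod ν' ≤ s⁻¹ * (D * (s * s)) := by gcongr
      _ = D * (s⁻¹ * s * s) := by ring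
      _ ≤ D * (1 * s) := by gcongr; exact ENNReal.inv_mul_le_one s
      _ = D * s := by rw [one_mul]

end Coupling


open scoped NNReal BoundedContinuousFunction

section Compactness

variable {X : Type*} [PseudoMetricSpace X]

lemma exists_finite_partition_of_unity {K : Set X} (hK : IsCompact K) {δ : ℝ≥0} (hδ : 0 < δ) :
    ∃ (t : Finset X) (φ : X → X →ᵇ ℝ≥0), (∀ x ∈ K, ∑ c ∈ t, φ c x = 1) ∧
      ∀ c x, φ c x ≠ 0 → nndist x c < δ := by
  obtain ⟨t, -, htf, hcov⟩ := hK.finite_cover_balls (e := δ / 2) (by positivity)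
  lift t to Finset X using htf
  have hδ2 : 0 < δ / 2 := by positivity
  set ψ : X → X → ℝ≥0 := fun c x => δ - nndist x c with hψ
  have hψc : ∀ c, Continuous (ψ c) := fun c => by fun_prop
  set m : X → ℝ≥0 := fun x => max (∑ c ∈ t, ψ c x) (δ / 2) with hm
  have hm0 : ∀ x, m x ≠ 0 := fun x => (hδ2.trans_le (le_max_right _ _)).ne'
  have hmc : Continuous m :=
    (continuous_finsetSum _ fun c _ => hψc c).max continuous_const
  have hb : ∀ c x, ψ c x / m x ≤ 2 := fun c x => by
    rw [div_le_iff₀ (pos_iff_ne_zero.2 (hm0 x))]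
    calc ψ c x ≤ δ := tsub_le_self
      _ = 2 * (δ / 2) := by rw [mul_div_cancel₀ _ (by norm_num)]
      _ ≤ 2 * m x := by gcongr; exact le_max_right _ _
  refine ⟨t, fun c => BoundedContinuousFunction.mkOfBound
    ⟨fun x => ψ c x / m x, (hψc c).div₀ hmc hm0⟩ 2 fun x y => ?_, fun x hx => ?_, fun c x h => ?_⟩
  · rw [NNReal.dist_eq, abs_sub_le_iff]
    have h1 : ((ψ c x / m x : ℝ≥0) : ℝ) ≤ 2 := by exact_mod_cast hb c x
    have h2 : ((ψ c y / m y : ℝ≥0) : ℝ) ≤ 2 := by exact_mod_cast hb c y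
    have h3 := (ψ c x / m x).coe_nonneg
    have h4 := (ψ c y / m y).coe_nonneg
    constructor <;> simp only [ContinuousMap.coe_mk] <;> linarith
  · change ∑ c ∈ t, ψ c x / m x = 1
    obtain ⟨c, hc, hxc⟩ := mem_iUnion₂.1 (hcov hx)
    have hxc' : nndist x c ≤ δ / 2 := by
      rw [← NNReal.coe_le_coe]
      simpa using (Metric.mem_ball.1 hxc).le
    have : δ / 2 ≤ ∑ c ∈ t, ψ c x := by
      refine le_trans ?_ (Finset.single_le_sum (f := fun c => ψ c x) (fun _ _ => zero_le) hc)
      refine le_tsub_of_add_le_left ?_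
      calc nndist x c + δ / 2 ≤ δ / 2 + δ / 2 := by gcongr
        _ = δ := add_halves δ
    rw [← Finset.sum_div]
    have hmx : m x = ∑ c ∈ t, ψ c x := max_eq_left this
    rw [← hmx, div_self (hm0 x)]
  · by_contra! hle
    exact h (by change ψ c x / m x = 0; simp [hψ, tsub_eq_zero_of_le hle])

variable [MeasurableSpace X]

/-- The probability measures concentrated on `K`. -/
def concentratedOn (K : Set X) : Set (ProbabilityMeasure X) :=
  {μ | ∀ᵐ x ∂(μ : Measure X), x ∈ K}

variable [BorelSpace X]

/-- On measures concentrated on a fixed compact set, weak convergence implies convergence for the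
Wasserstein distance. -/
lemma tendsto_wasserstein_of_tendsto {K : Set X} (hK : IsCompact K) {ι : Type*} {l : Filter ι}
    {μs : ι → ProbabilityMeasure X} {μ : ProbabilityMeasure X}
    (hs : ∀ i, μs i ∈ concentratedOn K) (hμ : μ ∈ concentratedOn K) (h : Tendsto μs l (𝓝 μ)) :
    Tendsto (fun i => wasserstein (μs i : Measure X) (μ : Measure X)) l (𝓝 0) := by
  rw [ENNReal.tendsto_nhds_zero]
  intro ε hε
  obtain ⟨δ, hδ, hδε⟩ := ENNReal.exists_nnreal_pos_mul_lt (a := 3) (by norm_num) hε.ne'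
  obtain ⟨t, φ, hφ1, hφδ⟩ := exists_finite_partition_of_unity hK hδ
  have hDt : Metric.ediam K ≠ ⊤ := hK.isBounded.ediam_ne_top
  set piece : ProbabilityMeasure X → t → Measure X :=
    fun ν c => (ν : Measure X).withDensity fun x => (φ c x : ℝ≥0∞) with hpiece
  have hφm : ∀ c, Measurable fun x => (φ c x : ℝ≥0∞) := fun c =>
    (φ c).continuous.measurable.coe_nnreal_ennreal
  have hsum : ∀ ν ∈ concentratedOn K, ∑ c, piece ν c = (ν : Measure X) := by
    intro ν hν
    ext A hA
    rw [Measure.finsetSum_apply]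
    simp only [hpiece, withDensity_apply _ hA]
    rw [← lintegral_finsetSum (f := fun (c : t) x => (φ c x : ℝ≥0∞)) _ fun c _ => hφm c]
    calc ∫⁻ x in A, ∑ c : t, (φ c x : ℝ≥0∞) ∂(ν : Measure X)
        = ∫⁻ x in A, 1 ∂(ν : Measure X) := by
          refine lintegral_congr_ae (ae_restrict_of_ae ?_)
          filter_upwards [hν] with x hx
          rw [← ENNReal.ofNNReal_finsetSum, Finset.sum_coe_sort t fun c => φ c x, hφ1 x hx]
          rfl
      _ = (ν : Measure X) A := by simp
  have hnear : ∀ (ν : ProbabilityMeasure X) (c : t), ∀ᵐ x ∂(piece ν c), edist x (c : X) ≤ δ := by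
    intro ν c
    refine (ae_withDensity_iff (hφm c)).2 ?_
    refine Eventually.of_forall fun x hx => ?_
    rw [edist_nndist]
    exact_mod_cast (hφδ c x (by exact_mod_cast hx)).le
  have hbound : ∀ i, wasserstein (μs i : Measure X) (μ : Measure X) ≤ (δ + δ) + Metric.ediam K *
      ∑ c : t, (∫⁻ x, φ c x ∂(μs i : Measure X) - ∫⁻ x, φ c x ∂(μ : Measure X)) := by
    intro i
    have i1 : IsProbabilityMeasure (∑ c, piece (μs i) c) := by rw [hsum _ (hs i)]; infer_instance
    have i2 : IsProbabilityMeasure (∑ c, piece μ c) := by rw [hsum _ hμ]; infer_instance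
    have := wasserstein_sum_le (piece (μs i)) (piece μ) (ε := δ + δ) (D := Metric.ediam K)
      (fun c => by
        filter_upwards [Measure.quasiMeasurePreserving_fst.ae (hnear (μs i) c),
          Measure.quasiMeasurePreserving_snd.ae (hnear μ c)] with p h1 h2
        exact (edist_triangle_right _ _ (c : X)).trans (add_le_add h1 h2))
      (by
        rw [hsum _ (hs i), hsum _ hμ]
        filter_upwards [Measure.quasiMeasurePreserving_fst.ae (hs i),
          Measure.quasiMeasurePreserving_snd.ae hμ] with p h1 h2
        exact Metric.edist_le_ediam_of_mem h1 h2)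
    rw [hsum _ (hs i), hsum _ hμ] at this
    simpa only [hpiece, withDensity_apply _ MeasurableSet.univ, Measure.restrict_univ] using this
  have hlim : Tendsto (fun i => Metric.ediam K *
      ∑ c : t, (∫⁻ x, φ c x ∂(μs i : Measure X) - ∫⁻ x, φ c x ∂(μ : Measure X))) l (𝓝 0) := by
    have h0 : Tendsto (fun i => ∑ c : t,
        (∫⁻ x, φ c x ∂(μs i : Measure X) - ∫⁻ x, φ c x ∂(μ : Measure X))) l (𝓝 (∑ c : t, 0)) := by
      refine tendsto_finsetSum _ fun c _ => ?_
      have hfin : ∫⁻ x, φ c x ∂(μ : Measure X) ≠ ⊤ :=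
        ((φ c).lintegral_lt_top_of_nnreal (μ : Measure X)).ne
      have := ENNReal.Tendsto.sub
        (ProbabilityMeasure.tendsto_iff_forall_lintegral_tendsto.1 h (φ c))
        (tendsto_const_nhds (x := ∫⁻ x, φ c x ∂(μ : Measure X))) (Or.inl hfin)
      simpa using this
    have := ENNReal.Tendsto.const_mul h0 (Or.inr hDt)
    simpa using this
  filter_upwards [(ENNReal.tendsto_nhds_zero.1 hlim) δ (by exact_mod_cast hδ)] with i hi
  calc _ ≤ (δ + δ : ℝ≥0∞) + δ := (hbound i).trans (by gcongr)
    _ = δ * 3 := by ring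
    _ ≤ ε := hδε.le

lemma isCompact_concentratedOn {X : Type*} [MetricSpace X] [MeasurableSpace X] [BorelSpace X]
    {K : Set X} (hK : IsCompact K) : IsCompact (concentratedOn K) := by
  have := isCompact_setOfPred_probabilityMeasure_mass_eq_compl_isCompact_le (E := X)
    (u := fun _ => 0) (K := fun _ => K) tendsto_const_nhds (fun _ => hK) (Or.inr monotone_const)
  convert this using 1
  ext μ
  simp only [concentratedOn, mem_ofPred_eq, forall_const, nonpos_iff_eq_zero]
  rw [ProbabilityMeasure.null_iff_toMeasure_null]
  rfl

end Compactness

section ArzelaAscoli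

variable {X : Type*} [MetricSpace X] [MeasurableSpace X] [BorelSpace X] [PolishSpace X]

/-- A uniformly Lipschitz sequence of curves of probability measures concentrated on a compact set
has a subsequence that converges uniformly for the Wasserstein distance. -/
lemma exists_subseq_tendsto_iSup_wasserstein {α : Type*} [PseudoMetricSpace α] [CompactSpace α]
    [Nonempty α] {K : Set X} (hK : IsCompact K) (u : ℕ → α → ProbabilityMeasure X)
    (hu : ∀ k t, u k t ∈ concentratedOn K) (L : ℝ≥0)
    (hL : ∀ k s t, wasserstein (u k s : Measure X) (u k t : Measure X) ≤ L * edist s t) :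
    ∃ (μ : α → ProbabilityMeasure X) (φ : ℕ → ℕ), StrictMono φ ∧
      (∀ t, μ t ∈ concentratedOn K) ∧
      Tendsto (fun k => ⨆ t, wasserstein (u (φ k) t : Measure X) (μ t : Measure X))
        atTop (𝓝 0) := by
  have hcomp := isCompact_concentratedOn hK
  set D : ℕ → α := TopologicalSpace.denseSeq α with hD
  obtain ⟨a, ha, φ, hφ, hlim⟩ := (isCompact_univ_pi fun _ : ℕ => hcomp).tendsto_subseq
    (x := fun k i => u k (D i)) (fun k i _ => hu k (D i))
  have haW : ∀ i, Tendsto (fun k => wasserstein (u (φ k) (D i) : Measure X) (a i : Measure X))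
      atTop (𝓝 0) := fun i => tendsto_wasserstein_of_tendsto hK (fun k => hu _ _)
    (ha i (mem_univ i)) ((tendsto_pi_nhds.1 hlim) i)
  choose μ hμ ψ hψ hlimψ using fun t => hcomp.tendsto_subseq (x := fun k => u (φ k) t)
    (fun k => hu _ _)
  have hμW : ∀ t, Tendsto (fun k => wasserstein (u (φ (ψ t k)) t : Measure X) (μ t : Measure X))
      atTop (𝓝 0) := fun t => tendsto_wasserstein_of_tendsto hK (fun k => hu _ _)
    (hμ t) (hlimψ t)
  refine ⟨μ, φ, hφ, hμ, ENNReal.tendsto_nhds_zero.2 fun ε hε => ?_⟩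
  obtain ⟨δ, hδ, hδε⟩ := ENNReal.exists_nnreal_pos_mul_lt (a := 2 * L + 3) (by finiteness) hε.ne'
  obtain ⟨I, hI⟩ := isCompact_univ.elim_finite_subcover (fun i => Metric.ball (D i) δ)
    (fun _ => Metric.isOpen_ball) (fun t _ => by
      obtain ⟨i, hi⟩ := (TopologicalSpace.denseRange_denseSeq α).exists_dist_lt t
        (NNReal.coe_pos.2 hδ)
      exact mem_iUnion.2 ⟨i, hi⟩)
  have hev : ∀ᶠ k in atTop, ∀ i ∈ I,
      wasserstein (u (φ k) (D i) : Measure X) (a i : Measure X) ≤ δ :=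
    (Filter.eventually_all_finset I).2 fun i _ =>
      ENNReal.tendsto_nhds_zero.1 (haW i) δ (by exact_mod_cast hδ)
  filter_upwards [hev] with k hk
  refine iSup_le fun t => ?_
  obtain ⟨i, hi, hti⟩ := mem_iUnion₂.1 (hI (mem_univ t))
  have hti' : edist t (D i) ≤ δ := by
    rw [edist_nndist]
    exact_mod_cast (Metric.mem_ball.1 hti).le
  obtain ⟨j, hj1, hj2⟩ := (((hψ t).tendsto_atTop.eventually hev).and
    (ENNReal.tendsto_nhds_zero.1 (hμW t) δ (by exact_mod_cast hδ))).exists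
  have hl : ∀ m, wasserstein (u m t : Measure X) (u m (D i) : Measure X) ≤ L * δ := fun m =>
    (hL m _ _).trans (by gcongr)
  have T := wasserstein_triangle (X := X)
  calc wasserstein (u (φ k) t : Measure X) (μ t : Measure X)
      ≤ wasserstein (u (φ k) t : Measure X) (u (φ k) (D i) : Measure X) +
        (wasserstein (u (φ k) (D i) : Measure X) (a i : Measure X) +
        (wasserstein (a i : Measure X) (u (φ (ψ t j)) (D i) : Measure X) +
        (wasserstein (u (φ (ψ t j)) (D i) : Measure X) (u (φ (ψ t j)) t : Measure X) +
        wasserstein (u (φ (ψ t j)) t : Measure X) (μ t : Measure X)))) :=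
        (T _ _ _).trans <| add_le_add_right ((T _ _ _).trans <| add_le_add_right
          ((T _ _ _).trans <| add_le_add_right (T _ _ _) _) _) _
    _ ≤ L * δ + (δ + (δ + (L * δ + δ))) := by
        refine add_le_add (hl _) (add_le_add (hk i hi) (add_le_add ?_ (add_le_add ?_ hj2)))
        · rw [wasserstein_comm]; exact hj1 i hi
        · rw [wasserstein_comm]; exact hl _
    _ = δ * (2 * L + 3) := by ring
    _ ≤ ε := hδε.le

end ArzelaAscoli


section Lattice

variable {n : ℕ}

/-- The index of the half-open cube of side `h` containing `y`. -/
noncomputable def cellIndex (h : ℝ) (y : Space n) : Fin n → ℤ := fun k => ⌊y k / h⌋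

/-- The corner of the half-open cube of side `h` containing `y`. -/
noncomputable def roundDown (h : ℝ) (y : Space n) : Space n := latticePoint h (cellIndex h y)

lemma measurable_cellIndex (h : ℝ) : Measurable (cellIndex (n := n) h) := by
  refine measurable_pi_lambda _ fun k => Int.measurable_floor.comp ?_
  fun_prop

lemma measurable_roundDown (h : ℝ) : Measurable (roundDown (n := n) h) :=
  (measurable_of_countable (latticePoint h)).comp (measurable_cellIndex h)

lemma mem_latticeCell_iff {h : ℝ} (hh : 0 < h) {z : Fin n → ℤ} {y : Space n} :
    y ∈ latticeCell h z ↔ cellIndex h y = z := by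
  rw [funext_iff]
  refine forall_congr' fun k => ?_
  rw [cellIndex, Int.floor_eq_iff, le_div_iff₀ hh, div_lt_iff₀ hh, mul_comm h, add_mul, one_mul]

lemma measurableSet_latticeCell {h : ℝ} (hh : 0 < h) (z : Fin n → ℤ) :
    MeasurableSet (latticeCell h z) := by
  have : latticeCell h z = cellIndex h ⁻¹' {z} := by
    ext y; exact mem_latticeCell_iff hh
  rw [this]
  exact measurable_cellIndex h (measurableSet_singleton z)

lemma cellIndex_latticePoint {h : ℝ} (hh : 0 < h) (z : Fin n → ℤ) :
    cellIndex h (latticePoint h z) = z := by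
  funext k
  simp [cellIndex, latticePoint, mul_div_cancel_left₀ _ hh.ne']

lemma norm_sub_roundDown_le {h : ℝ} (hh : 0 < h) (y : Space n) :
    ‖y - roundDown h y‖ ≤ √n * h := by
  have : ∀ k, ‖(y - roundDown h y) k‖ ^ 2 ≤ h ^ 2 := fun k => by
    have h1 := (mem_latticeCell_iff hh).2 (rfl : cellIndex h y = cellIndex h y) k
    have h2 : (y - roundDown h y) k = y k - h * (cellIndex h y k : ℝ) := rfl
    rw [h2, Real.norm_eq_abs, sq_abs]
    have h3 : 0 ≤ y k - h * (cellIndex h y k : ℝ) := by linarith [h1.1]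
    have h4 : y k - h * (cellIndex h y k : ℝ) ≤ h := by linarith [h1.2]
    gcongr
  rw [EuclideanSpace.norm_eq]
  calc √(∑ k, ‖(y - roundDown h y) k‖ ^ 2) ≤ √(∑ _k : Fin n, h ^ 2) := by
        exact Real.sqrt_le_sqrt (Finset.sum_le_sum fun k _ => this k)
    _ = √n * h := by
        rw [Finset.sum_const, Finset.card_univ, Fintype.card_fin, nsmul_eq_mul,
          Real.sqrt_mul (Nat.cast_nonneg _), Real.sqrt_sq hh.le]

lemma cellIndex_mem_piFinset {h : ℝ} (hh : 0 < h) {M : ℤ} {y : Space n} (hy : ‖y‖ ≤ M * h) :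
    cellIndex h y ∈ Fintype.piFinset fun _ : Fin n => Finset.Icc (-M) M := by
  refine Fintype.mem_piFinset.2 fun k => Finset.mem_Icc.2 ?_
  have hk := abs_le.1 ((PiLp.norm_apply_le y k).trans hy)
  constructor
  · refine Int.le_floor.2 ?_
    rw [le_div_iff₀ hh]
    push_cast
    linarith [hk.1]
  · have : (⌊y k / h⌋ : ℝ) ≤ M := (Int.floor_le _).trans ((div_le_iff₀ hh).2 hk.2)
    exact_mod_cast this

lemma timeStep_pos {N : ℕ} (hN : 0 < N) : 0 < timeStep N := by
  unfold timeStep; positivity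

lemma spaceStep_pos {N : ℕ} (hN : 0 < N) : 0 < spaceStep N := by
  unfold spaceStep; positivity

lemma cellIndex_mem_spaceIndices {N : ℕ} (hN : 0 < N) {y : Space n} (hy : ‖y‖ ≤ N) :
    cellIndex (spaceStep N) y ∈ spaceIndices n N := by
  refine cellIndex_mem_piFinset (spaceStep_pos hN) (hy.trans (le_of_eq ?_))
  have : (N : ℝ) ≠ 0 := by positivity
  rw [spaceStep]; push_cast; field_simp

lemma cellIndex_mem_velIndices {N : ℕ} (hN : 0 < N) {y : Space n} (hy : ‖y‖ ≤ N) :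
    cellIndex (timeStep N) y ∈ velIndices n N := by
  refine cellIndex_mem_piFinset (timeStep_pos hN) (hy.trans (le_of_eq ?_))
  have : (N : ℝ) ≠ 0 := by positivity
  rw [timeStep]; push_cast; field_simp

end Lattice

/-- A map that almost surely takes finitely many values has a finitely supported law. -/
lemma map_eq_sum_smul_dirac {Y X ι : Type*} [MeasurableSpace Y] [MeasurableSpace X]
    {ν : Measure Y} {s : Finset ι} {A : ι → Set Y} {f : Y → X} {c : ι → X}
    (hA : ∀ i ∈ s, MeasurableSet (A i)) (hf : AEMeasurable f ν)
    (h : ∀ᵐ y ∂ν, ∃ i ∈ s, (∀ j ∈ s, y ∈ A j ↔ j = i) ∧ f y = c i) :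
    ν.map f = ∑ i ∈ s, ν (A i) • Measure.dirac (c i) := by
  ext B hB
  classical
  calc ν.map f B = ∫⁻ y, B.indicator 1 (f y) ∂ν := by
        rw [← lintegral_map' (measurable_one.indicator hB).aemeasurable hf,
          lintegral_indicator_one hB]
    _ = ∫⁻ y, ∑ i ∈ s, (A i).indicator (fun _ => B.indicator 1 (c i)) y ∂ν := by
        refine lintegral_congr_ae ?_
        filter_upwards [h] with y ⟨i, hi, hij, hfy⟩
        rw [Finset.sum_eq_single_of_mem i hi fun j hj hne =>
          indicator_of_notMem (fun hy => hne ((hij j hj).1 hy)) _,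
          indicator_of_mem ((hij i hi).2 rfl), hfy]
    _ = ∑ i ∈ s, ν (A i) * B.indicator 1 (c i) := by
        rw [lintegral_finsetSum' _ fun i hi =>
          (measurable_const.indicator (hA i hi)).aemeasurable]
        refine Finset.sum_congr rfl fun i hi => ?_
        rw [lintegral_indicator_const (hA i hi), mul_comm]
    _ = (∑ i ∈ s, ν (A i) • Measure.dirac (c i)) B := by
        rw [Measure.finsetSum_apply]
        refine Finset.sum_congr rfl fun i _ => ?_
        rw [Measure.smul_apply, Measure.dirac_apply' _ hB, smul_eq_mul]

section LAS

variable {n : ℕ}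

lemma discSpace_eq_map {N : ℕ} (hN : 0 < N) {μ : Measure (Space n)}
    (h : ∀ᵐ x ∂μ, ‖x‖ ≤ N) : discSpace N μ = μ.map (roundDown (spaceStep N)) := by
  have hs := spaceStep_pos hN
  refine (map_eq_sum_smul_dirac (fun i _ => measurableSet_latticeCell hs i)
    (measurable_roundDown _).aemeasurable ?_).symm
  filter_upwards [h] with x hx
  refine ⟨_, cellIndex_mem_spaceIndices hN hx, fun j _ => ?_, rfl⟩
  rw [mem_latticeCell_iff hs, eq_comm]

/-- The displacement during the time `h` along the rounded velocities. -/
noncomputable def move (N : ℕ) (h : ℝ) (p : TSpace n) : Space n :=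
  p.fst + h • roundDown (timeStep N) p.snd

lemma measurable_move (N : ℕ) (h : ℝ) : Measurable (move (n := n) N h) := by
  have h1 : Measurable fun p : TSpace n => p.fst := by fun_prop
  have h2 : Measurable fun p : TSpace n => p.snd := by fun_prop
  exact h1.add (((measurable_roundDown _).comp h2).const_smul h)

lemma PVF.ae_fst (V : PVF n) {P : ProbabilityMeasure (Space n)} {q : Space n → Prop}
    (h : ∀ᵐ x ∂(P : Measure (Space n)), q x) : ∀ᵐ p ∂(V P : Measure (TSpace n)), q p.fst := by
  rw [← V.map_fst P] at h
  exact ae_of_ae_map (by fun_prop) h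

lemma PVF.onMeasure_coe (V : PVF n) (P : ProbabilityMeasure (Space n)) :
    V.onMeasure (P : Measure (Space n)) = V P := by
  rw [PVF.onMeasure, dif_pos (inferInstance : IsProbabilityMeasure (P : Measure (Space n)))]
  rfl

/-- `x` belongs to the space lattice. -/
def IsLatticePoint (N : ℕ) (x : Space n) : Prop := ∃ z, x = latticePoint (spaceStep N) z

lemma measurableSet_isLatticePoint (N : ℕ) :
    MeasurableSet {x : Space n | IsLatticePoint N x} := by
  have : {x : Space n | IsLatticePoint N x} = range (latticePoint (spaceStep N)) := by
    ext x; simp only [IsLatticePoint, mem_ofPred_eq, mem_range, eq_comm]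
  rw [this]
  exact (countable_range _).measurableSet

lemma lasMove_eq_map (V : PVF n) {N : ℕ} (hN : 0 < N) {P : ProbabilityMeasure (Space n)}
    (hP : ∀ᵐ x ∂(P : Measure (Space n)), ‖x‖ ≤ N ∧ IsLatticePoint N x)
    (hv : ∀ᵐ p ∂(V P : Measure (TSpace n)), ‖p.snd‖ ≤ N) (h : ℝ) :
    lasMove V N (P : Measure (Space n)) h = (V P : Measure (TSpace n)).map (move N h) := by
  have hs := spaceStep_pos hN
  have ht := timeStep_pos hN
  have h1 : Measurable fun p : TSpace n => p.fst := by fun_prop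
  have h2 : Measurable fun p : TSpace n => p.snd := by fun_prop
  rw [lasMove, ← Finset.sum_product']
  simp only [velMass, V.onMeasure_coe]
  refine (map_eq_sum_smul_dirac (s := spaceIndices n N ×ˢ velIndices n N)
    (A := fun i => {p : TSpace n | p.fst = latticePoint (spaceStep N) i.1 ∧
      p.snd ∈ latticeCell (timeStep N) i.2})
    (c := fun i => latticePoint (spaceStep N) i.1 + h • latticePoint (timeStep N) i.2)
    (fun i _ => (h1 (measurableSet_singleton _)).inter (h2 (measurableSet_latticeCell ht _)))
    (measurable_move N h).aemeasurable ?_).symm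
  filter_upwards [V.ae_fst hP, hv] with p ⟨hp, z, hz⟩ hpv
  have hzi : cellIndex (spaceStep N) p.fst = z := by rw [hz, cellIndex_latticePoint hs]
  refine ⟨(z, cellIndex (timeStep N) p.snd), Finset.mem_product.2
    ⟨hzi ▸ cellIndex_mem_spaceIndices hN hp, cellIndex_mem_velIndices hN hpv⟩, fun j _ => ?_, ?_⟩
  · rw [mem_latticeCell_iff ht, Prod.ext_iff]
    refine and_congr ⟨fun hj => ?_, fun hj => ?_⟩ eq_comm
    · rw [← hzi, hj, cellIndex_latticePoint hs]
    · rw [hz, hj]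
  · rw [move, ← hz, roundDown]

lemma IsLatticePoint.move {N : ℕ} (hN : 0 < N) {p : TSpace n} (hp : IsLatticePoint N p.fst) :
    IsLatticePoint N (move N (timeStep N) p) := by
  obtain ⟨z, hz⟩ := hp
  refine ⟨z + cellIndex (timeStep N) p.snd, ?_⟩
  rw [MDE.move, hz]
  ext k
  have : (N : ℝ) ≠ 0 := by positivity
  simp [roundDown, latticePoint, timeStep, spaceStep]
  field_simp

lemma norm_roundDown_le {N : ℕ} (hN : 0 < N) (v : Space n) :
    ‖roundDown (timeStep N) v‖ ≤ ‖v‖ + √n / N := by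
  have h1 := norm_sub_roundDown_le (timeStep_pos hN) v
  have h2 := norm_sub_norm_le (roundDown (timeStep N) v) v
  rw [norm_sub_rev] at h2
  have h3 : √n * timeStep N = √n / N := mul_one_div _ _
  linarith

lemma ae_norm_le_of_support_subset {P : ProbabilityMeasure (Space n)} {R : ℝ}
    (h : (P : Measure (Space n)).support ⊆ Metric.closedBall 0 R) :
    ∀ᵐ x ∂(P : Measure (Space n)), ‖x‖ ≤ R := by
  filter_upwards [Measure.support_mem_ae (μ := (P : Measure (Space n)))] with x hx
  simpa using h hx

lemma support_subset_of_ae_norm_le {P : ProbabilityMeasure (Space n)} {R : ℝ}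
    (h : ∀ᵐ x ∂(P : Measure (Space n)), ‖x‖ ≤ R) :
    (P : Measure (Space n)).support ⊆ Metric.closedBall 0 R :=
  Measure.support_subset_of_isClosed Metric.isClosed_closedBall <| by
    filter_upwards [h] with x hx
    simpa using hx

lemma hasCompactSupp_of_ae_norm_le {P : ProbabilityMeasure (Space n)} {R : ℝ}
    (h : ∀ᵐ x ∂(P : Measure (Space n)), ‖x‖ ≤ R) : HasCompactSupp P :=
  (isCompact_closedBall 0 R).of_isClosed_subset Measure.isClosed_support
    (support_subset_of_ae_norm_le h)

lemma PVF.SupportSublinear.ae_norm_snd_le {V : PVF n} {C : ℝ} (hV : V.SupportSublinear C)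
    (hC : 0 ≤ C) {P : ProbabilityMeasure (Space n)} {r : ℝ} (hr : 0 ≤ r)
    (h : ∀ᵐ x ∂(P : Measure (Space n)), ‖x‖ ≤ r) :
    ∀ᵐ p ∂(V P : Measure (TSpace n)), ‖p.snd‖ ≤ C * (1 + r) := by
  have hsup : ⨆ x ∈ (P : Measure (Space n)).support, ‖x‖ₑ ≤ ENNReal.ofReal r :=
    iSup₂_le fun x hx => by
      rw [← ofReal_norm]
      exact ENNReal.ofReal_le_ofReal (by simpa using support_subset_of_ae_norm_le h hx)
  filter_upwards [Measure.support_mem_ae (μ := (V P : Measure (TSpace n)))] with p hp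
  have h1 : ‖p.snd‖ₑ ≤ ENNReal.ofReal C * (1 + ENNReal.ofReal r) :=
    (le_iSup₂ (f := fun (p : TSpace n) (_ : p ∈ (V P : Measure (TSpace n)).support) => ‖p.snd‖ₑ)
      p hp).trans ((hV P (hasCompactSupp_of_ae_norm_le h)).trans (by gcongr))
  rw [← ENNReal.ofReal_one, ← ENNReal.ofReal_add zero_le_one hr, ← ENNReal.ofReal_mul hC,
    ← ofReal_norm] at h1
  exact (ENNReal.ofReal_le_ofReal_iff (by positivity)).1 h1

end LAS


section StepCurve

variable {n : ℕ}

/-- `Q` is the lattice approximate solution on `[0,T]`, a curve of probability measures that on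
each time cell moves the masses of `V (P ℓ)` along their rounded velocities; the positions on the
time grid are bounded by `A` and the rounded velocities by `B`. -/
structure IsStepCurve (V : PVF n) (N : ℕ) (μ₀ : ProbabilityMeasure (Space n)) (T A B : ℝ)
    (P : ℕ → ProbabilityMeasure (Space n)) (Q : ℝ → ProbabilityMeasure (Space n)) : Prop where
  pos : 0 < N
  coe_eq : ∀ t ∈ Icc 0 T, (Q t : Measure (Space n)) = las V N μ₀ t
  grid : ∀ ℓ : ℕ, ℓ * timeStep N ≤ T → Q (ℓ * timeStep N) = P ℓ
  eq_map : ∀ (ℓ : ℕ) (h : ℝ), 0 ≤ h → h ≤ timeStep N → ℓ * timeStep N + h ≤ T →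
    (Q (ℓ * timeStep N + h) : Measure (Space n)) =
      (V (P ℓ) : Measure (TSpace n)).map (move N h)
  bound : ∀ ℓ : ℕ, ℓ * timeStep N ≤ T → ∀ᵐ p ∂(V (P ℓ) : Measure (TSpace n)),
    ‖p.fst‖ ≤ A ∧ ‖p.snd‖ + √n / N ≤ B
  init : wasserstein (Q 0 : Measure (Space n)) μ₀ ≤ ENNReal.ofReal (√n / N)

/-- The bound `e^{CT}(1 + R + e + e/C)`, `e = √n/N`, for one plus the positions. -/
noncomputable def growthBound (n N : ℕ) (C R T : ℝ) : ℝ :=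
  (1 + R + √n / N + √n / N / C) * Real.exp (C * T)

lemma le_growthBound {N : ℕ} {C R T : ℝ} (hC : 0 ≤ C) (hR : 0 ≤ R) (hT : 0 ≤ T) :
    1 + R ≤ growthBound n N C R T := by
  have h1 : 0 ≤ √n / (N : ℝ) / C := by positivity
  have h2 : 0 ≤ √n / (N : ℝ) := by positivity
  calc 1 + R ≤ (1 + R + √n / N + √n / N / C) * 1 := by linarith
    _ ≤ growthBound n N C R T := by
      unfold growthBound
      gcongr
      exact Real.one_le_exp (by positivity)

lemma exists_lasGrid_eq {V : PVF n} {C : ℝ} (hC : 0 < C) (hV : V.SupportSublinear C) {T R : ℝ}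
    (hR : 0 ≤ R) {μ₀ : ProbabilityMeasure (Space n)}
    (hμ₀ : ∀ᵐ x ∂(μ₀ : Measure (Space n)), ‖x‖ ≤ R) {N : ℕ} (hN : 0 < N)
    (hA : growthBound n N C R T ≤ N) (hCA : C * growthBound n N C R T ≤ N) (ℓ : ℕ)
    (hℓ : ℓ * timeStep N ≤ T) :
    ∃ P : ProbabilityMeasure (Space n), (P : Measure (Space n)) = lasGrid V N μ₀ ℓ ∧
      (∀ᵐ x ∂(P : Measure (Space n)), ‖x‖ ≤ growthBound n N C R T ∧ IsLatticePoint N x) ∧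
      ∀ᵐ p ∂(V P : Measure (TSpace n)), ‖p.snd‖ + √n / N ≤ C * growthBound n N C R T := by
  have hN' : (0 : ℝ) < N := by exact_mod_cast hN
  have hN1 : (1 : ℝ) ≤ N := by exact_mod_cast hN
  set e : ℝ := √n / N with he
  have he0 : 0 ≤ e := by positivity
  have hs : ∀ ℓ : ℕ, ℓ * timeStep N ≤ T →
      (1 + R + e + e / C) * (1 + C / N) ^ ℓ ≤ growthBound n N C R T := by
    intro ℓ hℓ
    have : (1 + C / N) ^ ℓ ≤ Real.exp (C * T) := by
      calc (1 + C / N) ^ ℓ ≤ Real.exp (C / N) ^ ℓ := by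
            gcongr
            rw [add_comm]
            exact Real.add_one_le_exp _
        _ = Real.exp (C * (ℓ * timeStep N)) := by
            rw [← Real.exp_nat_mul, timeStep]; congr 1; field_simp
        _ ≤ Real.exp (C * T) := by gcongr
    unfold growthBound
    gcongr
  have hone : ∀ ℓ : ℕ, (1 + R + e + e / C) ≤ (1 + R + e + e / C) * (1 + C / N) ^ ℓ := fun ℓ =>
    le_mul_of_one_le_right (by positivity)
      (one_le_pow₀ (le_add_of_nonneg_right (by positivity)))
  have hrad : ∀ ℓ : ℕ, ℓ * timeStep N ≤ T → ∀ P : ProbabilityMeasure (Space n),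
      (∀ᵐ x ∂(P : Measure (Space n)),
        ‖x‖ ≤ (1 + R + e + e / C) * (1 + C / N) ^ ℓ - 1 - e / C) →
      ∀ᵐ p ∂(V P : Measure (TSpace n)),
        ‖p.snd‖ + e ≤ C * ((1 + R + e + e / C) * (1 + C / N) ^ ℓ) := by
    intro ℓ hℓ P hP
    filter_upwards [hV.ae_norm_snd_le hC.le (by linarith [hone ℓ]) hP] with p hp
    have : C * (1 + ((1 + R + e + e / C) * (1 + C / N) ^ ℓ - 1 - e / C)) + e =
        C * ((1 + R + e + e / C) * (1 + C / N) ^ ℓ) := by field_simp; ring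
    linarith
  have heC : 0 ≤ e / C := by positivity
  have key : ∀ ℓ : ℕ, ℓ * timeStep N ≤ T → ∃ P : ProbabilityMeasure (Space n),
      (P : Measure (Space n)) = lasGrid V N μ₀ ℓ ∧
      ∀ᵐ x ∂(P : Measure (Space n)),
        ‖x‖ ≤ (1 + R + e + e / C) * (1 + C / N) ^ ℓ - 1 - e / C ∧ IsLatticePoint N x := by
    intro ℓ
    induction ℓ with
    | zero =>
      intro h0
      have hRN : R ≤ N := by
        have := (hs 0 h0).trans hA
        simp only [pow_zero, mul_one] at this
        linarith
      have hm := measurable_roundDown (n := n) (spaceStep N)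
      refine ⟨μ₀.map hm.aemeasurable, ?_, ?_⟩
      · rw [lasGrid, discSpace_eq_map hN (hμ₀.mono fun x hx => hx.trans hRN)]
        rfl
      · rw [ProbabilityMeasure.toMeasure_map]
        refine (ae_map_iff hm.aemeasurable ?_).2 ?_
        · exact (measurableSet_le measurable_norm measurable_const).inter
            (measurableSet_isLatticePoint N)
        · filter_upwards [hμ₀] with x hx
          refine ⟨?_, _, rfl⟩
          have h1 := norm_sub_roundDown_le (spaceStep_pos hN) x
          have h2 := norm_sub_norm_le (roundDown (spaceStep N) x) x
          rw [norm_sub_rev] at h2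
          have h3 : √n * spaceStep N ≤ e := by
            rw [he, div_eq_mul_one_div, spaceStep]
            gcongr
            nlinarith
          simp only [pow_zero, mul_one]
          linarith
    | succ ℓ ih =>
      intro hℓ1
      have hτ := timeStep_pos hN
      have hℓ0 : ℓ * timeStep N ≤ T := by push_cast at hℓ1; nlinarith
      obtain ⟨P, hP, hPr⟩ := ih hℓ0
      have hvel := hrad ℓ hℓ0 P (hPr.mono fun x hx => hx.1)
      have hbd := hs ℓ hℓ0
      have hmove := lasMove_eq_map V hN (P := P)
        (hPr.mono fun x hx => ⟨by linarith [hx.1], hx.2⟩)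
        (hvel.mono fun p hp => by nlinarith) (timeStep N)
      have hm := measurable_move (n := n) N (timeStep N)
      refine ⟨(V P).map hm.aemeasurable, ?_, ?_⟩
      · rw [lasGrid, ← hP, hmove]; rfl
      · rw [ProbabilityMeasure.toMeasure_map]
        refine (ae_map_iff hm.aemeasurable ?_).2 ?_
        · exact (measurableSet_le measurable_norm measurable_const).inter
            (measurableSet_isLatticePoint N)
        · filter_upwards [V.ae_fst hPr, hvel] with p hp1 hp2
          refine ⟨?_, hp1.2.move hN⟩
          have h1 : ‖timeStep N • roundDown (timeStep N) p.snd‖ ≤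
              timeStep N * (C * ((1 + R + e + e / C) * (1 + C / N) ^ ℓ)) := by
            rw [norm_smul, Real.norm_of_nonneg hτ.le]
            gcongr
            exact (norm_roundDown_le hN _).trans hp2
          have h2 : timeStep N * (C * ((1 + R + e + e / C) * (1 + C / N) ^ ℓ)) =
              (1 + R + e + e / C) * (1 + C / N) ^ (ℓ + 1) -
                (1 + R + e + e / C) * (1 + C / N) ^ ℓ := by
            rw [timeStep]; ring
          have := norm_add_le p.fst (timeStep N • roundDown (timeStep N) p.snd)
          rw [move]
          linarith [hp1.1]
  obtain ⟨P, hP, hPr⟩ := key ℓ hℓ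
  have hbd := hs ℓ hℓ
  refine ⟨P, hP, hPr.mono fun x hx => ⟨by linarith [hx.1], hx.2⟩, ?_⟩
  filter_upwards [hrad ℓ hℓ P (hPr.mono fun x hx => hx.1)] with p hp
  nlinarith

end StepCurve


section StepCurveEstimates

variable {n : ℕ}

lemma las_eq_of_grid (V : PVF n) {N : ℕ} (hN : 0 < N) (μ₀ : ProbabilityMeasure (Space n)) (ℓ : ℕ)
    {h : ℝ} (h0 : 0 ≤ h) (h1 : h < timeStep N) :
    las V N μ₀ (ℓ * timeStep N + h) = lasMove V N (lasGrid V N μ₀ ℓ) h := by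
  have hN' : (0 : ℝ) < N := by exact_mod_cast hN
  have hNt : (N : ℝ) * timeStep N = 1 := by rw [timeStep]; field_simp
  have hfl : ⌊(N : ℝ) * (ℓ * timeStep N + h)⌋₊ = ℓ := by
    have e : (N : ℝ) * (ℓ * timeStep N + h) = ℓ + N * h := by
      rw [mul_add, mul_left_comm, hNt, mul_one]
    rw [e, Nat.floor_eq_iff (by positivity)]
    refine ⟨le_add_of_nonneg_right (by positivity), add_lt_add_right ?_ _⟩
    rw [← hNt]
    gcongr
  rw [las, hfl, add_sub_cancel_left]

lemma exists_eq_mul_timeStep_add {N : ℕ} (hN : 0 < N) {t : ℝ} (ht : 0 ≤ t) :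
    ∃ (ℓ : ℕ) (h : ℝ), 0 ≤ h ∧ h < timeStep N ∧ t = ℓ * timeStep N + h := by
  have hτ := timeStep_pos hN
  have h1 := Nat.floor_le (div_nonneg ht hτ.le)
  have h2 := Nat.lt_floor_add_one (t / timeStep N)
  rw [le_div_iff₀ hτ] at h1
  rw [div_lt_iff₀ hτ] at h2
  exact ⟨⌊t / timeStep N⌋₊, t - ⌊t / timeStep N⌋₊ * timeStep N, by linarith, by linarith, by ring⟩

open Classical in
/-- The measure `m` as a probability measure, and `d` if it is not one. -/
noncomputable def toProbabilityMeasure (d : ProbabilityMeasure (Space n)) (m : Measure (Space n)) :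
    ProbabilityMeasure (Space n) :=
  if h : IsProbabilityMeasure m then ⟨m, h⟩ else d

lemma coe_toProbabilityMeasure (d : ProbabilityMeasure (Space n)) (m : Measure (Space n))
    [h : IsProbabilityMeasure m] : (toProbabilityMeasure d m : Measure (Space n)) = m := by
  have e : toProbabilityMeasure d m = (⟨m, h⟩ : ProbabilityMeasure (Space n)) := dif_pos h
  rw [e]
  rfl

lemma exists_isStepCurve {V : PVF n} {C : ℝ} (hC : 0 < C) (hV : V.SupportSublinear C) {T R : ℝ}
    (hT : 0 ≤ T) (hR : 0 ≤ R) {μ₀ : ProbabilityMeasure (Space n)}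
    (hμ₀ : ∀ᵐ x ∂(μ₀ : Measure (Space n)), ‖x‖ ≤ R) {N : ℕ} (hN : 0 < N)
    (hA : growthBound n N C R T ≤ N) (hCA : C * growthBound n N C R T ≤ N) :
    ∃ P Q, IsStepCurve V N μ₀ T (growthBound n N C R T) (C * growthBound n N C R T) P Q := by
  have hτ := timeStep_pos hN
  set P : ℕ → ProbabilityMeasure (Space n) := fun ℓ =>
    toProbabilityMeasure μ₀ (lasGrid V N μ₀ ℓ)
  set Q : ℝ → ProbabilityMeasure (Space n) := fun t =>
    toProbabilityMeasure μ₀ (las V N μ₀ t)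
  have hgrid := fun ℓ hℓ => exists_lasGrid_eq hC hV hR hμ₀ hN hA hCA ℓ hℓ
  have hPe : ∀ ℓ : ℕ, ℓ * timeStep N ≤ T → (P ℓ : Measure (Space n)) = lasGrid V N μ₀ ℓ := by
    intro ℓ hℓ
    obtain ⟨P', h1, -⟩ := hgrid ℓ hℓ
    have : IsProbabilityMeasure (lasGrid V N μ₀ ℓ) := h1 ▸ inferInstance
    exact coe_toProbabilityMeasure _ _
  have hPl : ∀ ℓ : ℕ, ℓ * timeStep N ≤ T →
      (∀ᵐ x ∂(P ℓ : Measure (Space n)), ‖x‖ ≤ growthBound n N C R T ∧ IsLatticePoint N x) ∧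
      ∀ᵐ p ∂(V (P ℓ) : Measure (TSpace n)), ‖p.snd‖ + √n / N ≤ C * growthBound n N C R T := by
    intro ℓ hℓ
    obtain ⟨P', h1, h2, h3⟩ := hgrid ℓ hℓ
    have : P' = P ℓ := Subtype.ext (h1.trans (hPe ℓ hℓ).symm)
    subst this
    exact ⟨h2, h3⟩
  have hmove : ∀ ℓ : ℕ, ℓ * timeStep N ≤ T → ∀ h : ℝ, lasMove V N (lasGrid V N μ₀ ℓ) h =
      (V (P ℓ) : Measure (TSpace n)).map (move N h) := by
    intro ℓ hℓ h
    have he : (0 : ℝ) ≤ √n / N := by positivity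
    rw [← hPe ℓ hℓ]
    exact lasMove_eq_map V hN ((hPl ℓ hℓ).1.mono fun x hx => ⟨hx.1.trans hA, hx.2⟩)
      ((hPl ℓ hℓ).2.mono fun p hp => by linarith) h
  have hlas0 : ∀ ℓ : ℕ, ℓ * timeStep N ≤ T → las V N μ₀ (ℓ * timeStep N) = P ℓ := by
    intro ℓ hℓ
    have h1 := las_eq_of_grid V hN μ₀ ℓ le_rfl hτ
    rw [add_zero, hmove ℓ hℓ] at h1
    rw [h1, ← V.map_fst]
    congr 1
    funext p
    simp [move]
  have hlas : ∀ (ℓ : ℕ) (h : ℝ), 0 ≤ h → h ≤ timeStep N → ℓ * timeStep N + h ≤ T →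
      las V N μ₀ (ℓ * timeStep N + h) = (V (P ℓ) : Measure (TSpace n)).map (move N h) := by
    intro ℓ h h0 h1 hle
    have hℓ : ℓ * timeStep N ≤ T := by linarith
    rcases h1.lt_or_eq with h1 | rfl
    · rw [las_eq_of_grid V hN μ₀ ℓ h0 h1, hmove ℓ hℓ]
    · have e : (ℓ : ℝ) * timeStep N + timeStep N = ((ℓ + 1 : ℕ) : ℝ) * timeStep N := by
        push_cast; ring
      rw [e] at hle ⊢
      rw [hlas0 _ hle, hPe _ hle, lasGrid, hmove ℓ hℓ]
  have hQe : ∀ t ∈ Icc 0 T, (Q t : Measure (Space n)) = las V N μ₀ t := by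
    intro t ht
    obtain ⟨ℓ, h, h0, h1, rfl⟩ := exists_eq_mul_timeStep_add hN ht.1
    have : IsProbabilityMeasure (las V N μ₀ (ℓ * timeStep N + h)) := by
      rw [hlas ℓ h h0 h1.le ht.2]
      exact Measure.isProbabilityMeasure_map (measurable_move N h).aemeasurable
    exact coe_toProbabilityMeasure _ _
  refine ⟨P, Q, hN, hQe, fun ℓ hℓ => ?_, fun ℓ h h0 h1 hle => ?_, fun ℓ hℓ => ?_, ?_⟩
  · refine Subtype.ext ((hQe _ ⟨by positivity, hℓ⟩).trans (hlas0 ℓ hℓ))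
  · rw [hQe _ ⟨by positivity, hle⟩, hlas ℓ h h0 h1 hle]
  · filter_upwards [V.ae_fst (hPl ℓ hℓ).1, (hPl ℓ hℓ).2] with p h1 h2 using ⟨h1.1, h2⟩
  · have hRA : R ≤ growthBound n N C R T := by
      linarith [le_growthBound (n := n) (N := N) hC.le hR hT]
    have h0 := hlas0 0 (by simpa using hT)
    rw [hPe 0 (by simpa using hT), Nat.cast_zero, zero_mul, lasGrid,
      discSpace_eq_map hN (hμ₀.mono fun x hx => hx.trans (hRA.trans hA))] at h0
    rw [hQe 0 ⟨le_rfl, hT⟩, h0]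
    have := wasserstein_map_le_of_ae (μ₀ : Measure (Space n))
      (measurable_roundDown (spaceStep N)) measurable_id (c := ENNReal.ofReal (√n / N))
      (Eventually.of_forall fun x => by
        rw [id, edist_dist, dist_comm, dist_eq_norm]
        refine ENNReal.ofReal_le_ofReal ((norm_sub_roundDown_le (spaceStep_pos hN) x).trans ?_)
        have hN1 : (1 : ℝ) ≤ N := by exact_mod_cast hN
        rw [div_eq_mul_one_div (√n), spaceStep]
        gcongr
        nlinarith)
    rwa [Measure.map_id] at this

namespace IsStepCurve

variable {V : PVF n} {N : ℕ} {μ₀ : ProbabilityMeasure (Space n)} {T A B : ℝ}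
  {P : ℕ → ProbabilityMeasure (Space n)} {Q : ℝ → ProbabilityMeasure (Space n)}

lemma ae_norm_roundDown_le (hQ : IsStepCurve V N μ₀ T A B P Q) {ℓ : ℕ}
    (hℓ : ℓ * timeStep N ≤ T) :
    ∀ᵐ p ∂(V (P ℓ) : Measure (TSpace n)), ‖roundDown (timeStep N) p.snd‖ ≤ B :=
  (hQ.bound ℓ hℓ).mono fun p hp => (norm_roundDown_le hQ.pos p.snd).trans hp.2

lemma bound_nonneg (hQ : IsStepCurve V N μ₀ T A B P Q) (hT : 0 ≤ T) : 0 ≤ B := by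
  obtain ⟨p, hp⟩ := (hQ.ae_norm_roundDown_le (ℓ := 0) (by simpa using hT)).exists
  exact (norm_nonneg _).trans hp

lemma wasserstein_cell_le (hQ : IsStepCurve V N μ₀ T A B P Q) (ℓ : ℕ) {h h' : ℝ} (h0 : 0 ≤ h)
    (hh' : h ≤ h') (h1 : h' ≤ timeStep N) (hT : ℓ * timeStep N + h' ≤ T) :
    wasserstein (Q (ℓ * timeStep N + h) : Measure (Space n)) (Q (ℓ * timeStep N + h')) ≤
      ENNReal.ofReal (B * (h' - h)) := by
  rw [hQ.eq_map ℓ h h0 (hh'.trans h1) (by linarith), hQ.eq_map ℓ h' (h0.trans hh') h1 hT]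
  refine wasserstein_map_le_of_ae _ (measurable_move N h) (measurable_move N h') ?_
  filter_upwards [hQ.ae_norm_roundDown_le (ℓ := ℓ) (by linarith)] with p hp
  rw [edist_dist, dist_comm, dist_eq_norm, move, move, add_sub_add_left_eq_sub, ← sub_smul,
    norm_smul, Real.norm_of_nonneg (by linarith), mul_comm]
  exact ENNReal.ofReal_le_ofReal (mul_le_mul_of_nonneg_right hp (by linarith))

lemma wasserstein_le_of_le (hQ : IsStepCurve V N μ₀ T A B P Q) {s t : ℝ} (h0 : 0 ≤ s)
    (hst : s ≤ t) (htT : t ≤ T) :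
    wasserstein (Q s : Measure (Space n)) (Q t) ≤ ENNReal.ofReal (B * (t - s)) := by
  have hτ := timeStep_pos hQ.pos
  have hB := hQ.bound_nonneg (h0.trans (hst.trans htT))
  obtain ⟨ℓ, h, hh0, hh1, rfl⟩ := exists_eq_mul_timeStep_add hQ.pos h0
  have key : ∀ m : ℕ, ∀ t, ℓ * timeStep N + h ≤ t → t ≤ T → t ≤ (ℓ + m + 1) * timeStep N →
      wasserstein (Q (ℓ * timeStep N + h) : Measure (Space n)) (Q t) ≤
        ENNReal.ofReal (B * (t - (ℓ * timeStep N + h))) := by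
    intro m
    induction m with
    | zero =>
      intro t h1 h2 h3
      simp only [Nat.cast_zero, add_zero] at h3
      have := hQ.wasserstein_cell_le ℓ (h' := t - ℓ * timeStep N) hh0 (by linarith) (by linarith)
        (by linarith)
      rw [add_sub_cancel] at this
      refine this.trans (le_of_eq ?_)
      congr 2; ring
    | succ m ih =>
      intro t h1 h2 h3
      push_cast at h3
      rcases le_total t ((ℓ + m + 1) * timeStep N) with h4 | h4
      · exact ih t h1 h2 h4
      · have hm : (0 : ℝ) ≤ m * timeStep N := by positivity
        have i1 := ih ((ℓ + m + 1) * timeStep N) (by linarith) (h4.trans h2) le_rfl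
        have i2 := hQ.wasserstein_cell_le (ℓ + m + 1) (h := 0)
          (h' := t - (ℓ + m + 1) * timeStep N) le_rfl
          (by linarith) (by linarith) (by push_cast; linarith)
        push_cast at i2
        rw [add_sub_cancel, add_zero] at i2
        refine (wasserstein_triangle _ _ _).trans ((add_le_add i1 i2).trans ?_)
        rw [← ENNReal.ofReal_add (mul_nonneg hB (by linarith)) (mul_nonneg hB (by linarith))]
        refine ENNReal.ofReal_le_ofReal (le_of_eq ?_)
        ring
  obtain ⟨m, hm⟩ := exists_nat_ge ((t - ℓ * timeStep N) / timeStep N)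
  rw [div_le_iff₀ hτ] at hm
  exact key m t hst htT (by linarith)

lemma wasserstein_le (hQ : IsStepCurve V N μ₀ T A B P Q) {s t : ℝ} (hs : s ∈ Icc 0 T)
    (ht : t ∈ Icc 0 T) :
    wasserstein (Q s : Measure (Space n)) (Q t) ≤ ENNReal.ofReal (B * |s - t|) := by
  rcases le_total s t with h | h
  · rw [abs_sub_comm, abs_of_nonneg (sub_nonneg.2 h)]
    exact hQ.wasserstein_le_of_le hs.1 h ht.2
  · rw [abs_of_nonneg (sub_nonneg.2 h), wasserstein_comm]
    exact hQ.wasserstein_le_of_le ht.1 h hs.2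

lemma mem_concentratedOn (hQ : IsStepCurve V N μ₀ T A B P Q) {t : ℝ} (ht : t ∈ Icc 0 T) :
    Q t ∈ concentratedOn (Metric.closedBall (0 : Space n) (A + B)) := by
  have hB := hQ.bound_nonneg (ht.1.trans ht.2)
  obtain ⟨ℓ, h, h0, h1, rfl⟩ := exists_eq_mul_timeStep_add hQ.pos ht.1
  have hℓ : ℓ * timeStep N ≤ T := by linarith [ht.2]
  change ∀ᵐ x ∂(Q (ℓ * timeStep N + h) : Measure (Space n)), x ∈ Metric.closedBall 0 (A + B)
  rw [hQ.eq_map ℓ h h0 h1.le ht.2]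
  refine (ae_map_iff (measurable_move N h).aemeasurable measurableSet_closedBall).2 ?_
  filter_upwards [hQ.bound ℓ hℓ, hQ.ae_norm_roundDown_le hℓ] with p hp hp'
  rw [dist_zero_right, move]
  refine (norm_add_le _ _).trans (add_le_add hp.1 ?_)
  have hN1 : (1 : ℝ) ≤ N := by exact_mod_cast hQ.pos
  have : timeStep N ≤ 1 := by rw [timeStep]; exact div_le_one_of_le₀ hN1 (by positivity)
  rw [norm_smul, Real.norm_of_nonneg h0]
  exact (mul_le_of_le_one_left (norm_nonneg _) (by linarith)).trans hp'

end IsStepCurve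

end StepCurveEstimates


open scoped NNReal

section TestFunctions

variable {n : ℕ}

lemma gradPairing_eq (f : Space n → ℝ) (p : TSpace n) :
    gradPairing f p = fderiv ℝ f p.fst p.snd :=
  inner_gradient_left

/-- `f` has a derivative bounded by `M` and Lipschitz with constant `K`. -/
structure HasLipschitzDeriv (f : Space n → ℝ) (M K : ℝ≥0) : Prop where
  pos : 0 < M
  differentiable : Differentiable ℝ f
  norm_fderiv_le : ∀ x, ‖fderiv ℝ f x‖ ≤ M
  lipschitz_fderiv : LipschitzWith K (fderiv ℝ f)

lemma exists_hasLipschitzDeriv {f : Space n → ℝ} (hf : ContDiff ℝ ∞ f)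
    (hfc : HasCompactSupport f) : ∃ M K, HasLipschitzDeriv f M K := by
  obtain ⟨K, hK⟩ := ContDiff.lipschitzWith_of_hasCompactSupport (n := 1) (hfc.fderiv ℝ)
    (hf.fderiv_right (by norm_cast)) (by norm_num)
  obtain ⟨M, hM⟩ := (hfc.fderiv ℝ).exists_bound_of_continuous (hf.continuous_fderiv (by simp))
  refine ⟨M.toNNReal + 1, K, by positivity, hf.differentiable (by simp), fun x => ?_, hK⟩
  push_cast
  exact (hM x).trans ((Real.le_coe_toNNReal M).trans (by linarith))

namespace HasLipschitzDeriv

variable {f : Space n → ℝ} {M K : ℝ≥0}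

lemma lipschitzWith (hf : HasLipschitzDeriv f M K) : LipschitzWith M f :=
  lipschitzWith_of_nnnorm_fderiv_le hf.differentiable fun x => by
    exact_mod_cast hf.norm_fderiv_le x

lemma abs_gradPairing_le (hf : HasLipschitzDeriv f M K) (p : TSpace n) :
    |gradPairing f p| ≤ M * ‖p.snd‖ := by
  rw [gradPairing_eq, ← Real.norm_eq_abs]
  exact ((fderiv ℝ f p.fst).le_opNorm _).trans (by gcongr; exact hf.norm_fderiv_le _)

lemma abs_gradPairing_sub_le (hf : HasLipschitzDeriv f M K) (p q : TSpace n) :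
    |gradPairing f p - gradPairing f q| ≤ (K * ‖p.snd‖ + M) * dist p q := by
  have e : gradPairing f p - gradPairing f q =
      (fderiv ℝ f p.fst - fderiv ℝ f q.fst) p.snd + fderiv ℝ f q.fst (p.snd - q.snd) := by
    rw [gradPairing_eq, gradPairing_eq]; simp
  have h1 : ‖(fderiv ℝ f p.fst - fderiv ℝ f q.fst) p.snd‖ ≤ K * dist p q * ‖p.snd‖ := by
    refine (ContinuousLinearMap.le_opNorm _ _).trans ?_
    gcongr
    rw [← dist_eq_norm]
    exact (hf.lipschitz_fderiv.dist_le_mul _ _).trans (by gcongr; exact WithLp.dist_fst_le _ _)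
  have h2 : ‖fderiv ℝ f q.fst (p.snd - q.snd)‖ ≤ M * dist p q := by
    refine (ContinuousLinearMap.le_opNorm _ _).trans ?_
    gcongr
    · exact hf.norm_fderiv_le _
    · rw [← dist_eq_norm]; exact WithLp.dist_snd_le _ _
  rw [e, ← Real.norm_eq_abs]
  exact (norm_add_le _ _).trans ((add_le_add h1 h2).trans (le_of_eq (by ring)))

lemma continuous_gradPairing (hf : HasLipschitzDeriv f M K) : Continuous (gradPairing f) := by
  have h : gradPairing f = fun p : TSpace n => fderiv ℝ f p.fst p.snd :=
    funext (gradPairing_eq f)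
  have h1 : Continuous fun p : TSpace n => p.fst := by fun_prop
  have h2 : Continuous fun p : TSpace n => p.snd := by fun_prop
  rw [h]
  exact (hf.lipschitz_fderiv.continuous.comp h1).clm_apply h2

lemma abs_taylor_le (hf : HasLipschitzDeriv f M K) (x w : Space n) :
    |f (x + w) - f x - fderiv ℝ f x w| ≤ K * ‖w‖ * ‖w‖ := by
  have := (convex_closedBall x ‖w‖).norm_image_sub_le_of_norm_fderiv_le' (𝕜 := ℝ) (f := f)
    (φ := fderiv ℝ f x) (C := K * ‖w‖) (x := x) (y := x + w)
    (fun y _ => hf.differentiable y) (fun y hy => by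
      rw [← dist_eq_norm]
      exact (hf.lipschitz_fderiv.dist_le_mul _ _).trans (by gcongr; exact hy))
    (Metric.mem_closedBall_self (norm_nonneg w)) (by simp [dist_eq_norm])
  simpa using this

lemma integrable_of_ae_norm_le (hf : HasLipschitzDeriv f M K) {μ : Measure (Space n)}
    [IsFiniteMeasure μ] {A : ℝ} (h : ∀ᵐ x ∂μ, ‖x‖ ≤ A) : Integrable f μ := by
  refine Integrable.of_bound hf.differentiable.continuous.aestronglyMeasurable (‖f 0‖ + M * A) ?_
  filter_upwards [h] with x hx
  have h1 := hf.lipschitzWith.dist_le_mul x 0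
  rw [dist_eq_norm, dist_zero_right] at h1
  have h2 := norm_sub_norm_le (f x) (f 0)
  have h3 : (M : ℝ) * ‖x‖ ≤ M * A := by gcongr
  linarith

lemma integrable_gradPairing (hf : HasLipschitzDeriv f M K) {μ : Measure (TSpace n)}
    [IsFiniteMeasure μ] {B : ℝ} (h : ∀ᵐ p ∂μ, ‖p.snd‖ ≤ B) : Integrable (gradPairing f) μ := by
  refine Integrable.of_bound hf.continuous_gradPairing.aestronglyMeasurable (M * B) ?_
  filter_upwards [h] with p hp
  exact (hf.abs_gradPairing_le p).trans (by gcongr)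

lemma abs_integral_gradPairing_le (hf : HasLipschitzDeriv f M K) {μ : Measure (TSpace n)}
    [IsProbabilityMeasure μ] {B : ℝ} (h : ∀ᵐ p ∂μ, ‖p.snd‖ ≤ B) :
    |∫ p, gradPairing f p ∂μ| ≤ M * B := by
  have := norm_integral_le_of_norm_le_const (μ := μ) (f := gradPairing f) (C := M * B) (by
    filter_upwards [h] with p hp
    exact (hf.abs_gradPairing_le p).trans (by gcongr))
  simpa using this

/-- Continuity of `P ↦ ∫ ∇f · v dV[P]` for the Wasserstein distance. -/
lemma tendsto_integral_gradPairing (hf : HasLipschitzDeriv f M K) {V : PVF n} {C : ℝ} (hC : 0 ≤ C)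
    (hV : V.SupportSublinear C) (hc : V.WassersteinContinuous) {r : ℝ} (hr : 0 ≤ r) {ι : Type*}
    {l : Filter ι} {P : ι → ProbabilityMeasure (Space n)} {P₀ : ProbabilityMeasure (Space n)}
    (hP : ∀ᶠ i in l, P i ∈ concentratedOn (Metric.closedBall 0 r))
    (hP₀ : P₀ ∈ concentratedOn (Metric.closedBall 0 r))
    (h : Tendsto (fun i => wasserstein (P i : Measure (Space n)) P₀) l (𝓝 0)) :
    Tendsto (fun i => ∫ p, gradPairing f p ∂(V (P i) : Measure (TSpace n))) l
      (𝓝 (∫ p, gradPairing f p ∂(V P₀ : Measure (TSpace n)))) := by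
  have hball : ∀ {Q : ProbabilityMeasure (Space n)}, Q ∈ concentratedOn (Metric.closedBall 0 r) →
      ∀ᵐ x ∂(Q : Measure (Space n)), ‖x‖ ≤ r := fun {Q} hQ => by
    filter_upwards [hQ] with x hx
    simpa using hx
  have hvel : ∀ {Q : ProbabilityMeasure (Space n)}, Q ∈ concentratedOn (Metric.closedBall 0 r) →
      ∀ᵐ p ∂(V Q : Measure (TSpace n)), ‖p.snd‖ ≤ C * (1 + r) := fun {Q} hQ =>
    hV.ae_norm_snd_le hC hr (hball hQ)
  set L : ℝ := K * (C * (1 + r)) + M with hL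
  have hM : (0 : ℝ) < M := hf.pos
  have hL0 : 0 < L := by positivity
  have hVW : Tendsto (fun i => wasserstein (V (P i) : Measure (TSpace n)) (V P₀)) l (𝓝 0) := by
    refine ENNReal.tendsto_nhds_zero.2 fun ε hε => ?_
    obtain ⟨δ, hδ, hδε⟩ := hc P₀ (hasCompactSupp_of_ae_norm_le (hball hP₀)) ε hε
    filter_upwards [hP, h.eventually (gt_mem_nhds hδ)] with i hi hi'
    exact (hδε _ (hasCompactSupp_of_ae_norm_le (hball hi)) hi').le
  rw [tendsto_iff_edist_tendsto_0]
  have hlim : Tendsto (fun i => ENNReal.ofReal L *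
      wasserstein (V (P i) : Measure (TSpace n)) (V P₀)) l (𝓝 0) := by
    simpa using ENNReal.Tendsto.const_mul hVW (Or.inr ENNReal.ofReal_ne_top)
  refine tendsto_of_tendsto_of_tendsto_of_le_of_le' tendsto_const_nhds hlim
    (Eventually.of_forall fun _ => bot_le) ?_
  filter_upwards [hP] with i hi
  rw [edist_eq_enorm_sub]
  refine enorm_integral_sub_le_wasserstein (hf.integrable_gradPairing (hvel hi))
    (hf.integrable_gradPairing (hvel hP₀)) (by simpa using hL0) ENNReal.ofReal_ne_top ?_
  filter_upwards [hvel hi] with p hp q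
  rw [edist_dist, ← ENNReal.ofReal_mul hL0.le, ← ofReal_norm]
  refine ENNReal.ofReal_le_ofReal ((hf.abs_gradPairing_sub_le p q).trans ?_)
  rw [hL]
  gcongr

lemma enorm_integral_sub_le (hf : HasLipschitzDeriv f M K) {P Q : Measure (Space n)}
    [IsFiniteMeasure P] [IsFiniteMeasure Q] {A A' : ℝ} (hP : ∀ᵐ x ∂P, ‖x‖ ≤ A)
    (hQ : ∀ᵐ x ∂Q, ‖x‖ ≤ A') :
    ‖∫ x, f x ∂P - ∫ x, f x ∂Q‖ₑ ≤ M * wasserstein P Q := by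
  refine enorm_integral_sub_le_wasserstein (hf.integrable_of_ae_norm_le hP)
    (hf.integrable_of_ae_norm_le hQ) (by exact_mod_cast hf.pos.ne') ENNReal.coe_ne_top
    (Eventually.of_forall fun x y => ?_)
  rw [← edist_eq_enorm_sub]
  exact hf.lipschitzWith x y

end HasLipschitzDeriv

end TestFunctions

section StepIntegral

/-- A function whose increments on the cells of a grid are `J ℓ` times the increments of time, up
to a relative error `c`, is the integral of the step function up to the error `c`. -/
lemma abs_sub_integral_step_le {F : ℝ → ℝ} {J : ℕ → ℝ} {τ c T : ℝ} (hτ : 0 < τ)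
    (h : ∀ (ℓ : ℕ) (h : ℝ), 0 ≤ h → h ≤ τ → ℓ * τ + h ≤ T →
      |F (ℓ * τ + h) - F (ℓ * τ) - h * J ℓ| ≤ c * h) {t : ℝ} (ht : t ∈ Icc 0 T) :
    |F t - F 0 - ∫ s in (0 : ℝ)..t, J ⌊s / τ⌋₊| ≤ c * t := by
  have hcell : ∀ (ℓ : ℕ) (h : ℝ), 0 ≤ h → h ≤ τ →
      EqOn (fun _ => J ℓ) (fun s => J ⌊s / τ⌋₊) (uIoo (ℓ * τ) (ℓ * τ + h)) := by
    intro ℓ h h0 h1 s hs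
    rw [uIoo_of_le (by linarith)] at hs
    have hfl : ⌊s / τ⌋₊ = ℓ := by
      have hs0 : 0 ≤ s := le_trans (by positivity) hs.1.le
      rw [Nat.floor_eq_iff (by positivity), le_div_iff₀ hτ, div_lt_iff₀ hτ]
      exact ⟨hs.1.le, by linarith [hs.2]⟩
    simp only [hfl]
  have hint : ∀ (ℓ : ℕ) (h : ℝ), 0 ≤ h → h ≤ τ →
      IntervalIntegrable (fun s => J ⌊s / τ⌋₊) volume (ℓ * τ) (ℓ * τ + h) := fun ℓ h h0 h1 =>
    intervalIntegrable_const.congr_uIoo (hcell ℓ h h0 h1)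
  have hval : ∀ (ℓ : ℕ) (h : ℝ), 0 ≤ h → h ≤ τ →
      ∫ s in (ℓ * τ)..(ℓ * τ + h), J ⌊s / τ⌋₊ = h * J ℓ := fun ℓ h h0 h1 => by
    rw [← intervalIntegral.integral_congr_uIoo (hcell ℓ h h0 h1), intervalIntegral.integral_const]
    simp
  have step : ∀ (ℓ : ℕ) (h : ℝ), 0 ≤ h → h ≤ τ →  ℓ * τ + h ≤ T →
      IntervalIntegrable (fun s => J ⌊s / τ⌋₊) volume 0 (ℓ * τ) ∧
        |F (ℓ * τ) - F 0 - ∫ s in (0 : ℝ)..(ℓ * τ), J ⌊s / τ⌋₊| ≤ c * (ℓ * τ) →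
      IntervalIntegrable (fun s => J ⌊s / τ⌋₊) volume 0 (ℓ * τ + h) ∧
        |F (ℓ * τ + h) - F 0 - ∫ s in (0 : ℝ)..(ℓ * τ + h), J ⌊s / τ⌋₊| ≤ c * (ℓ * τ + h) := by
    rintro ℓ k h0 h1 hle ⟨ih1, ih2⟩
    refine ⟨ih1.trans (hint ℓ k h0 h1), ?_⟩
    rw [← intervalIntegral.integral_add_adjacent_intervals ih1 (hint ℓ k h0 h1), hval ℓ k h0 h1]
    have := (abs_add_le _ _).trans (add_le_add ih2 (h ℓ k h0 h1 hle))
    refine le_trans (le_of_eq ?_) (this.trans (le_of_eq (by ring)))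
    congr 1; ring
  have key : ∀ ℓ : ℕ, ℓ * τ ≤ T → IntervalIntegrable (fun s => J ⌊s / τ⌋₊) volume 0 (ℓ * τ) ∧
      |F (ℓ * τ) - F 0 - ∫ s in (0 : ℝ)..(ℓ * τ), J ⌊s / τ⌋₊| ≤ c * (ℓ * τ) := by
    intro ℓ
    induction ℓ with
    | zero => intro _; simp
    | succ ℓ ih =>
      intro hℓ
      have e : ((ℓ + 1 : ℕ) : ℝ) * τ = ℓ * τ + τ := by push_cast; ring
      rw [e] at hℓ ⊢
      exact step ℓ τ hτ.le le_rfl hℓ (ih (by linarith))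
  have h1 := Nat.floor_le (div_nonneg ht.1 hτ.le)
  have h2 := Nat.lt_floor_add_one (t / τ)
  rw [le_div_iff₀ hτ] at h1
  rw [div_lt_iff₀ hτ] at h2
  have := (step ⌊t / τ⌋₊ (t - ⌊t / τ⌋₊ * τ) (by linarith) (by linarith)
    (by linarith [ht.2]) (key _ (h1.trans ht.2))).2
  rwa [add_sub_cancel] at this

end StepIntegral


open scoped NNReal

variable {n : ℕ}

lemma ae_norm_le_of_mem_concentratedOn {P : ProbabilityMeasure (Space n)} {r : ℝ}
    (h : P ∈ concentratedOn (Metric.closedBall 0 r)) : ∀ᵐ x ∂(P : Measure (Space n)), ‖x‖ ≤ r := by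
  filter_upwards [h] with x hx
  simpa using hx

/-- Over a time cell, the integral of `f` along a lattice approximate solution grows at the rate
`∫ ∇f · v dV` up to an error of order `1/N`. -/
lemma IsStepCurve.abs_increment_le {V : PVF n} {N : ℕ} {μ₀ : ProbabilityMeasure (Space n)}
    {T A B : ℝ} {P : ℕ → ProbabilityMeasure (Space n)} {Q : ℝ → ProbabilityMeasure (Space n)}
    (hQ : IsStepCurve V N μ₀ T A B P Q) {f : Space n → ℝ} {M K : ℝ≥0}
    (hf : HasLipschitzDeriv f M K) (ℓ : ℕ) {h : ℝ} (h0 : 0 ≤ h) (h1 : h ≤ timeStep N)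
    (hle : ℓ * timeStep N + h ≤ T) :
    |∫ x, f x ∂(Q (ℓ * timeStep N + h) : Measure (Space n)) -
      ∫ x, f x ∂(Q (ℓ * timeStep N) : Measure (Space n)) -
      h * ∫ p, gradPairing f p ∂(V (P ℓ) : Measure (TSpace n))| ≤
      ((K * B * B + M * √n) / N) * h := by
  have hτ := timeStep_pos hQ.pos
  have hN : (0 : ℝ) < N := by exact_mod_cast hQ.pos
  have hℓ : ℓ * timeStep N ≤ T := by linarith
  have hB : 0 ≤ B := hQ.bound_nonneg ((by positivity : (0 : ℝ) ≤ ℓ * timeStep N).trans hℓ)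
  have hmap : ∀ k, 0 ≤ k → k ≤ timeStep N → ℓ * timeStep N + k ≤ T →
      Integrable (fun p => f (move N k p)) (V (P ℓ) : Measure (TSpace n)) ∧
      ∫ x, f x ∂(Q (ℓ * timeStep N + k) : Measure (Space n)) =
        ∫ p, f (move N k p) ∂(V (P ℓ) : Measure (TSpace n)) := by
    intro k k0 k1 hk
    have hi := hf.integrable_of_ae_norm_le (ae_norm_le_of_mem_concentratedOn
      (hQ.mem_concentratedOn (t := ℓ * timeStep N + k) ⟨by positivity, hk⟩))
    rw [hQ.eq_map ℓ k k0 k1 hk] at hi ⊢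
    exact ⟨hi.comp_measurable (measurable_move N k),
      integral_map (measurable_move N k).aemeasurable hi.1⟩
  obtain ⟨i1, e1⟩ := hmap h h0 h1 hle
  obtain ⟨i0, e0⟩ := hmap 0 le_rfl hτ.le (by simpa using hℓ)
  rw [add_zero] at e0
  have i10 : Integrable (fun p => f (move N h p) - f (move N 0 p))
      (V (P ℓ) : Measure (TSpace n)) := i1.sub i0
  have i2 := (hf.integrable_gradPairing (μ := (V (P ℓ) : Measure (TSpace n))) (B := B) <| by
    filter_upwards [hQ.bound ℓ hℓ] with p hp
    have : 0 ≤ √n / (N : ℝ) := by positivity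
    linarith [hp.2]).const_mul h
  rw [e1, e0, ← integral_const_mul, ← integral_sub i1 i0, ← integral_sub i10 i2,
    ← Real.norm_eq_abs]
  refine (norm_integral_le_of_norm_le_const ?_).trans (le_of_eq (by
    rw [probReal_univ, mul_one]))
  filter_upwards [hQ.ae_norm_roundDown_le hℓ] with p hp
  set w := roundDown (timeStep N) p.snd with hw
  have hhw : ‖h • w‖ = h * ‖w‖ := by rw [norm_smul, Real.norm_of_nonneg h0]
  have t1 : |f (p.fst + h • w) - f p.fst - fderiv ℝ f p.fst (h • w)| ≤
      K * (h * B) * (1 / N * B) := by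
    refine (hf.abs_taylor_le _ _).trans ?_
    rw [hhw]
    have : h ≤ 1 / N := h1
    gcongr
  have t2 : |fderiv ℝ f p.fst (h • (w - p.snd))| ≤ M * (h * (√n / N)) := by
    refine ((fderiv ℝ f p.fst).le_opNorm _).trans ?_
    rw [norm_smul, Real.norm_of_nonneg h0, norm_sub_rev]
    gcongr
    · exact hf.norm_fderiv_le _
    · refine (norm_sub_roundDown_le hτ p.snd).trans (le_of_eq ?_)
      rw [timeStep, mul_one_div]
  have e : f (move N h p) - f (move N 0 p) - h * gradPairing f p =
      (f (p.fst + h • w) - f p.fst - fderiv ℝ f p.fst (h • w)) +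
        fderiv ℝ f p.fst (h • (w - p.snd)) := by
    rw [gradPairing_eq, move, move, zero_smul, add_zero, ← hw]
    simp only [map_smul, map_sub, smul_eq_mul]
    ring
  change ‖f (move N h p) - f (move N 0 p) - h * gradPairing f p‖ ≤ _
  rw [e]
  refine (abs_add_le _ _).trans ((add_le_add t1 t2).trans (le_of_eq ?_))
  field_simp

/-- A pointwise limit of curves with Lipschitz constants tending to `B` has Lipschitz
constant `B`. -/
lemma wasserstein_le_of_tendsto {q q' : ℕ → ProbabilityMeasure (Space n)}
    {m m' : ProbabilityMeasure (Space n)}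
    (h : Tendsto (fun k => wasserstein (q k : Measure (Space n)) m) atTop (𝓝 0))
    (h' : Tendsto (fun k => wasserstein (q' k : Measure (Space n)) m') atTop (𝓝 0))
    {b : ℕ → ℝ} {B : ℝ} (hb : Tendsto b atTop (𝓝 B))
    (hle : ∀ᶠ k in atTop,
      wasserstein (q k : Measure (Space n)) (q' k) ≤ ENNReal.ofReal (b k)) :
    wasserstein (m : Measure (Space n)) m' ≤ ENNReal.ofReal B := by
  have hlim := (h.add ((ENNReal.tendsto_ofReal hb).add h'))
  rw [zero_add, add_zero] at hlim
  refine ge_of_tendsto hlim ?_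
  filter_upwards [hle] with k hk
  refine (wasserstein_triangle _ (q k : Measure (Space n)) _).trans (add_le_add
    (wasserstein_comm _ _).le ((wasserstein_triangle _ (q' k : Measure (Space n)) _).trans ?_))
  gcongr

/-- A pointwise limit of lattice approximate solutions is a weak solution. -/
theorem isSolution_of_tendsto {V : PVF n} {C : ℝ} (hC : 0 ≤ C) (hV : V.SupportSublinear C)
    (hc : V.WassersteinContinuous) {T A B : ℝ} (hT : 0 < T) (hA : 0 ≤ A)
    {μ₀ : ProbabilityMeasure (Space n)} {N : ℕ → ℕ} (hN : Tendsto N atTop atTop)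
    {P : ℕ → ℕ → ProbabilityMeasure (Space n)} {Q : ℕ → ℝ → ProbabilityMeasure (Space n)}
    (hQ : ∀ k, IsStepCurve V (N k) μ₀ T A B (P k) (Q k)) {μ : ℝ → ProbabilityMeasure (Space n)}
    (hμ0 : μ 0 = μ₀)
    (hμ : ∀ t ∈ Icc 0 T, μ t ∈ concentratedOn (Metric.closedBall 0 (A + B)))
    (hlim : ∀ t ∈ Icc 0 T,
      Tendsto (fun k => wasserstein (Q k t : Measure (Space n)) (μ t)) atTop (𝓝 0)) :
    IsSolution V T μ₀ μ := by
  refine ⟨hμ0, fun f hf hfc => ?_⟩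
  obtain ⟨M, K, hfd⟩ := exists_hasLipschitzDeriv hf hfc
  have hB : 0 ≤ B := (hQ 0).bound_nonneg hT.le
  have hAB : 0 ≤ A + B := by positivity
  have hvel : ∀ {R : ProbabilityMeasure (Space n)},
      R ∈ concentratedOn (Metric.closedBall 0 (A + B)) →
      ∀ᵐ p ∂(V R : Measure (TSpace n)), ‖p.snd‖ ≤ C * (1 + (A + B)) := fun {R} hR =>
    hV.ae_norm_snd_le hC hAB (ae_norm_le_of_mem_concentratedOn hR)
  set F : ℝ → ℝ := fun t => ∫ x, f x ∂(μ t : Measure (Space n)) with hF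
  set I : ℝ → ℝ := fun s => ∫ p, gradPairing f p ∂(V (μ s) : Measure (TSpace n)) with hI
  have hlip : ∀ s ∈ Icc 0 T, ∀ t ∈ Icc 0 T,
      wasserstein (μ s : Measure (Space n)) (μ t) ≤ ENNReal.ofReal (B * |s - t|) :=
    fun s hs t ht => wasserstein_le_of_tendsto (hlim s hs) (hlim t ht) tendsto_const_nhds
      (Eventually.of_forall fun k => (hQ k).wasserstein_le hs ht)
  have hIc : ContinuousOn I (Icc 0 T) := by
    intro s hs
    refine hfd.tendsto_integral_gradPairing hC hV hc hAB
      (eventually_mem_nhdsWithin.mono fun t ht => hμ t ht) (hμ s hs) ?_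
    have h0 : Tendsto (fun t => ENNReal.ofReal (B * |t - s|)) (𝓝[Icc 0 T] s) (𝓝 0) := by
      have : Continuous fun t : ℝ => ENNReal.ofReal (B * |t - s|) :=
        ENNReal.continuous_ofReal.comp (by fun_prop)
      have := (this.tendsto s).mono_left (nhdsWithin_le_nhds (s := Icc 0 T))
      simpa using this
    refine tendsto_of_tendsto_of_tendsto_of_le_of_le' tendsto_const_nhds h0
      (Eventually.of_forall fun _ => bot_le) ?_
    filter_upwards [self_mem_nhdsWithin] with t ht using hlip t ht s hs
  have hFlip : LipschitzOnWith (M * B.toNNReal) F (Icc 0 T) := by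
    intro s hs t ht
    rw [edist_eq_enorm_sub]
    refine (hfd.enorm_integral_sub_le (ae_norm_le_of_mem_concentratedOn (hμ s hs))
      (ae_norm_le_of_mem_concentratedOn (hμ t ht))).trans ?_
    rw [ENNReal.coe_mul, mul_assoc]
    gcongr
    refine (hlip s hs t ht).trans (le_of_eq ?_)
    rw [ENNReal.ofReal_mul hB, edist_dist, Real.dist_eq]
    rfl
  have hFlim : ∀ t ∈ Icc 0 T,
      Tendsto (fun k => ∫ x, f x ∂(Q k t : Measure (Space n))) atTop (𝓝 (F t)) := by
    intro t ht
    rw [tendsto_iff_edist_tendsto_0]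
    have h0 : Tendsto (fun k => (M : ℝ≥0∞) * wasserstein (Q k t : Measure (Space n)) (μ t))
        atTop (𝓝 0) := by
      simpa using ENNReal.Tendsto.const_mul (hlim t ht) (Or.inr ENNReal.coe_ne_top)
    refine tendsto_of_tendsto_of_tendsto_of_le_of_le tendsto_const_nhds h0
      (fun _ => bot_le) fun k => ?_
    rw [edist_eq_enorm_sub]
    exact hfd.enorm_integral_sub_le
      (ae_norm_le_of_mem_concentratedOn ((hQ k).mem_concentratedOn ht))
      (ae_norm_le_of_mem_concentratedOn (hμ t ht))
  set J : ℕ → ℕ → ℝ := fun k ℓ => ∫ p, gradPairing f p ∂(V (P k ℓ) : Measure (TSpace n)) with hJ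
  have hτ0 : Tendsto (fun k => timeStep (N k)) atTop (𝓝 0) :=
    tendsto_one_div_atTop_nhds_zero_nat.comp hN
  have hfloor : ∀ k, ∀ s ∈ Icc 0 T, ⌊s / timeStep (N k)⌋₊ * timeStep (N k) ∈ Icc 0 T ∧
      |⌊s / timeStep (N k)⌋₊ * timeStep (N k) - s| ≤ timeStep (N k) := by
    intro k s hs
    have hτ := timeStep_pos (hQ k).pos
    have h1 := Nat.floor_le (div_nonneg hs.1 hτ.le)
    have h2 := Nat.lt_floor_add_one (s / timeStep (N k))
    rw [le_div_iff₀ hτ] at h1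
    rw [div_lt_iff₀ hτ] at h2
    refine ⟨⟨by positivity, h1.trans hs.2⟩, abs_le.2 ⟨by linarith, by linarith⟩⟩
  have hPmem : ∀ k, ∀ s ∈ Icc 0 T, P k ⌊s / timeStep (N k)⌋₊ ∈
      concentratedOn (Metric.closedBall 0 (A + B)) := fun k s hs => by
    rw [← (hQ k).grid _ (hfloor k s hs).1.2]
    exact (hQ k).mem_concentratedOn (hfloor k s hs).1
  have hJlim : ∀ s ∈ Icc 0 T, Tendsto (fun k => J k ⌊s / timeStep (N k)⌋₊) atTop (𝓝 (I s)) := by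
    intro s hs
    refine hfd.tendsto_integral_gradPairing hC hV hc hAB
      (Eventually.of_forall fun k => hPmem k s hs) (hμ s hs) ?_
    have h0 : Tendsto (fun k => ENNReal.ofReal (B * timeStep (N k)) +
        wasserstein (Q k s : Measure (Space n)) (μ s)) atTop (𝓝 0) := by
      have := (ENNReal.tendsto_ofReal (hτ0.const_mul B)).add (hlim s hs)
      simpa using this
    refine tendsto_of_tendsto_of_tendsto_of_le_of_le tendsto_const_nhds h0
      (fun _ => bot_le) fun k => ?_
    dsimp only
    rw [← (hQ k).grid _ (hfloor k s hs).1.2]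
    refine (wasserstein_triangle _ (Q k s : Measure (Space n)) _).trans ?_
    gcongr
    refine ((hQ k).wasserstein_le (hfloor k s hs).1 hs).trans (ENNReal.ofReal_le_ofReal ?_)
    gcongr
    exact (hfloor k s hs).2
  have hmain : ∀ t ∈ Icc 0 T, F t - F 0 = ∫ s in (0 : ℝ)..t, I s := by
    intro t ht
    have hint : Tendsto (fun k => ∫ s in (0 : ℝ)..t, J k ⌊s / timeStep (N k)⌋₊) atTop
        (𝓝 (∫ s in (0 : ℝ)..t, I s)) := by
      refine intervalIntegral.tendsto_integral_filter_of_dominated_convergence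
        (fun _ => M * (C * (1 + (A + B)))) (Eventually.of_forall fun k => ?_)
        (Eventually.of_forall fun k => Eventually.of_forall fun s hs => ?_)
        intervalIntegrable_const (Eventually.of_forall fun s hs => ?_)
      · exact ((measurable_of_countable (J k)).comp
          (Nat.measurable_floor.comp (measurable_id.div_const _))).aestronglyMeasurable
      · rw [uIoc_of_le ht.1] at hs
        exact hfd.abs_integral_gradPairing_le (hvel (hPmem k s ⟨hs.1.le, hs.2.trans ht.2⟩))
      · rw [uIoc_of_le ht.1] at hs
        exact hJlim s ⟨hs.1.le, hs.2.trans ht.2⟩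
    have herr : Tendsto (fun k => (K * B * B + M * √n) / (N k : ℝ) * t) atTop (𝓝 0) := by
      have := ((tendsto_const_div_atTop_nhds_zero_nat (K * B * B + M * √n)).comp hN).mul_const t
      simpa using this
    have hle : ∀ k, |∫ x, f x ∂(Q k t : Measure (Space n)) -
        ∫ x, f x ∂(Q k 0 : Measure (Space n)) - ∫ s in (0 : ℝ)..t, J k ⌊s / timeStep (N k)⌋₊| ≤
        (K * B * B + M * √n) / (N k : ℝ) * t := fun k =>
      abs_sub_integral_step_le (F := fun t => ∫ x, f x ∂(Q k t : Measure (Space n)))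
        (timeStep_pos (hQ k).pos)
        (fun ℓ h h0 h1 hle => (hQ k).abs_increment_le hfd ℓ h0 h1 hle) ht
    have hl := (((hFlim t ht).sub (hFlim 0 ⟨le_rfl, hT.le⟩)).sub hint).abs
    have := le_of_tendsto_of_tendsto' hl herr hle
    exact sub_eq_zero.1 (abs_nonpos_iff.1 this)
  refine ⟨ae_restrict_of_forall_mem measurableSet_Icc fun s hs =>
    hfd.integrable_gradPairing (hvel (hμ s hs)), hIc.integrableOn_Icc, ?_, ?_⟩
  · refine LipschitzOnWith.absolutelyContinuousOnInterval (K := M * B.toNNReal) ?_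
    rwa [uIcc_of_le hT.le]
  · rw [← Measure.restrict_congr_set Ioo_ae_eq_Icc]
    refine ae_restrict_of_forall_mem measurableSet_Ioo fun t ht => ?_
    have hIo : ContinuousOn I (Ioo 0 T) := hIc.mono Ioo_subset_Icc_self
    have hd := intervalIntegral.integral_hasDerivAt_right (f := I) (a := 0) (b := t)
      ((hIc.mono (by
        rw [uIcc_of_le ht.1.le]
        exact Icc_subset_Icc_right ht.2.le)).intervalIntegrable)
      (hIo.stronglyMeasurableAtFilter isOpen_Ioo t ht)
      (hIo.continuousAt (isOpen_Ioo.mem_nhds ht))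
    refine (hd.const_add (F 0)).congr_of_eventuallyEq ?_
    filter_upwards [isOpen_Ioo.mem_nhds ht] with s hs
    rw [← hmain s (Ioo_subset_Icc_self hs)]
    ring


lemma IsStepCurve.mono {V : PVF n} {N : ℕ} {μ₀ : ProbabilityMeasure (Space n)}
    {T A B A' B' : ℝ} {P : ℕ → ProbabilityMeasure (Space n)} {Q : ℝ → ProbabilityMeasure (Space n)}
    (h : IsStepCurve V N μ₀ T A B P Q) (hA : A ≤ A') (hB : B ≤ B') :
    IsStepCurve V N μ₀ T A' B' P Q :=
  { h with bound := fun ℓ hℓ => (h.bound ℓ hℓ).mono fun _ hp =>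
      ⟨hp.1.trans hA, hp.2.trans hB⟩ }

lemma growthBound_nonneg {N : ℕ} {C R T : ℝ} (hC : 0 ≤ C) (hR : 0 ≤ R) :
    0 ≤ growthBound n N C R T := by
  unfold growthBound; positivity

lemma growthBound_le_one {N : ℕ} (hN : 0 < N) {C R T : ℝ} (hC : 0 ≤ C) :
    growthBound n N C R T ≤ growthBound n 1 C R T := by
  have hN1 : (1 : ℝ) ≤ N := by exact_mod_cast hN
  have : √n / (N : ℝ) ≤ √n / (1 : ℕ) := by
    rw [Nat.cast_one]
    gcongr
  unfold growthBound
  gcongr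

lemma tendsto_growthBound (C R T : ℝ) :
    Tendsto (fun N => growthBound n N C R T) atTop (𝓝 ((1 + R) * Real.exp (C * T))) := by
  have h := tendsto_const_div_atTop_nhds_zero_nat √n
  have := (((h.const_add (1 + R)).add (h.div_const C)).mul_const (Real.exp (C * T)))
  simpa [growthBound] using this

end MDE

theorem theorem3p1 (n : ℕ) (V : MDE.PVF n) (C : ℝ) (hC : 0 < C)
    (hH1 : V.SupportSublinear C) (hH2 : V.WassersteinContinuous)
    (T : ℝ) (hT : 0 < T)
    (μ₀ : ProbabilityMeasure (MDE.Space n)) (hμ₀ : MDE.HasCompactSupp μ₀) :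
    ∃ μ : ℝ → ProbabilityMeasure (MDE.Space n),
      (∀ t ∈ Icc 0 T, MDE.HasCompactSupp (μ t)) ∧
      MDE.IsSolution V T μ₀ μ ∧
      (∃ φ : ℕ → ℕ, StrictMono φ ∧
        Tendsto (fun k => ⨆ t ∈ Icc 0 T,
          MDE.wasserstein (MDE.las V (φ k) μ₀ t) (μ t : Measure (MDE.Space n))) atTop (𝓝 0)) ∧
      (∀ R : ℝ, (μ₀ : Measure (MDE.Space n)).support ⊆ Metric.closedBall 0 R →
        ∀ t ∈ Icc 0 T, ∀ s ∈ Icc 0 T,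
          MDE.wasserstein (μ t : Measure (MDE.Space n)) (μ s : Measure (MDE.Space n)) ≤
            ENNReal.ofReal (C * Real.exp (C * T) * (R + 1) * |t - s|)) := by
  open MDE in
  obtain ⟨R₁, hR₁⟩ := hμ₀.isBounded.subset_closedBall 0
  set R := max R₁ 0 with hR
  have hR0 : 0 ≤ R := le_max_right _ _
  have hae : ∀ᵐ x ∂(μ₀ : Measure (Space n)), ‖x‖ ≤ R :=
    (ae_norm_le_of_support_subset hR₁).mono fun x hx => hx.trans (le_max_left _ _)
  set A := growthBound n 1 C R T with hA
  have hA0 : 0 ≤ A := growthBound_nonneg hC.le hR0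
  obtain ⟨N₀, hN₀⟩ := exists_nat_ge (max A (C * A))
  have hcurve : ∀ k : ℕ, ∃ P Q, IsStepCurve V (N₀ + 1 + k) μ₀ T A (C * A) P Q := by
    intro k
    have hpos : 0 < N₀ + 1 + k := by omega
    have hg := growthBound_le_one (n := n) (R := R) (T := T) hpos hC.le
    have hle : max A (C * A) ≤ ((N₀ + 1 + k : ℕ) : ℝ) := hN₀.trans (by push_cast; linarith)
    have hCg := mul_le_mul_of_nonneg_left hg hC.le
    obtain ⟨P, Q, h⟩ := exists_isStepCurve hC hH1 hT.le hR0 hae hpos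
      (hg.trans ((le_max_left _ _).trans hle)) (hCg.trans ((le_max_right _ _).trans hle))
    exact ⟨P, Q, h.mono hg hCg⟩
  choose P Q hPQ using hcurve
  have hB0 : 0 ≤ C * A := by positivity
  have hne : Nonempty (Icc 0 T) := ⟨⟨0, le_rfl, hT.le⟩⟩
  obtain ⟨ν, φ, hφ, hν, hlim⟩ := exists_subseq_tendsto_iSup_wasserstein
    (isCompact_closedBall (0 : Space n) (A + C * A)) (fun k (t : Icc 0 T) => Q k t)
    (fun k t => (hPQ k).mem_concentratedOn t.2) (C * A).toNNReal
    (fun k s t => by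
      refine ((hPQ k).wasserstein_le s.2 t.2).trans (le_of_eq ?_)
      rw [ENNReal.ofReal_mul hB0, edist_dist, Subtype.dist_eq, Real.dist_eq]
      rfl)
  set N : ℕ → ℕ := fun k => N₀ + 1 + φ k with hN
  have hNmono : StrictMono N := fun i j hij => Nat.add_lt_add_left (hφ hij) _
  set μ : ℝ → ProbabilityMeasure (Space n) :=
    Function.update (fun t => ν (projIcc 0 T hT.le t)) 0 μ₀ with hμ
  have hμ0 : μ 0 = μ₀ := Function.update_self _ _ _
  have hμt : ∀ t (ht : t ∈ Icc 0 T), t ≠ 0 → μ t = ν ⟨t, ht⟩ := fun t ht h0 => by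
    rw [hμ, Function.update_of_ne h0, projIcc_of_mem hT.le ht]
  have hsup : Tendsto (fun k => ⨆ t ∈ Icc 0 T,
      wasserstein (Q (φ k) t : Measure (Space n)) (μ t)) atTop (𝓝 0) := by
    have h0 : Tendsto (fun k => ENNReal.ofReal (√n / N k)) atTop (𝓝 0) := by
      have := ENNReal.tendsto_ofReal
        ((tendsto_const_div_atTop_nhds_zero_nat √n).comp hNmono.tendsto_atTop)
      simpa using this
    have h1 := h0.add hlim
    rw [add_zero] at h1
    refine tendsto_of_tendsto_of_tendsto_of_le_of_le tendsto_const_nhds h1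
      (fun _ => bot_le) fun k => iSup₂_le fun t ht => ?_
    by_cases ht0 : t = 0
    · subst ht0
      rw [hμ0]
      exact (hPQ (φ k)).init.trans le_self_add
    · rw [hμt t ht ht0]
      exact (le_iSup (fun t : Icc 0 T =>
        wasserstein (Q (φ k) t : Measure (Space n)) (ν t)) ⟨t, ht⟩).trans le_add_self
  have hpt : ∀ t ∈ Icc 0 T,
      Tendsto (fun k => wasserstein (Q (φ k) t : Measure (Space n)) (μ t)) atTop (𝓝 0) :=
    fun t ht => tendsto_of_tendsto_of_tendsto_of_le_of_le tendsto_const_nhds hsup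
      (fun _ => bot_le) fun k => le_iSup₂ (f := fun t (_ : t ∈ Icc 0 T) =>
        wasserstein (Q (φ k) t : Measure (Space n)) (μ t)) t ht
  have hconc : ∀ t ∈ Icc 0 T, μ t ∈ concentratedOn (Metric.closedBall 0 (A + C * A)) := by
    intro t ht
    by_cases ht0 : t = 0
    · have hRA : R ≤ A + C * A := by
        have h1 : 1 + R ≤ A := le_growthBound hC.le hR0 hT.le
        linarith
      rw [ht0, hμ0]
      filter_upwards [hae] with x hx
      simpa using hx.trans hRA
    · rw [hμt t ht ht0]
      exact hν _
  refine ⟨μ, fun t ht => hasCompactSupp_of_ae_norm_le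
    (ae_norm_le_of_mem_concentratedOn (hconc t ht)),
    isSolution_of_tendsto hC.le hH1 hH2 hT hA0 hNmono.tendsto_atTop (fun k => hPQ (φ k)) hμ0
      hconc hpt, ⟨N, hNmono, ?_⟩, fun R' hR' t ht s hs => ?_⟩
  · refine hsup.congr fun k => iSup_congr fun t => iSup_congr fun ht => ?_
    rw [(hPQ (φ k)).coe_eq t ht]
  · have hae' := ae_norm_le_of_support_subset hR'
    have hR'0 : 0 ≤ R' := by
      obtain ⟨x, hx⟩ := hae'.exists
      exact (norm_nonneg x).trans hx
    have hg := tendsto_growthBound (n := n) C R' T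
    have hCg := hg.const_mul C
    have hcast := tendsto_natCast_atTop_atTop (R := ℝ)
    have hev : ∀ᶠ N : ℕ in atTop, 0 < N ∧ growthBound n N C R' T ≤ N ∧
        C * growthBound n N C R' T ≤ N := by
      filter_upwards [eventually_gt_atTop 0,
        hg.eventually (gt_mem_nhds (lt_add_one _)), hCg.eventually (gt_mem_nhds (lt_add_one _)),
        hcast.eventually (eventually_ge_atTop ((1 + R') * Real.exp (C * T) + 1)),
        hcast.eventually (eventually_ge_atTop (C * ((1 + R') * Real.exp (C * T)) + 1))]
        with N h0 h1 h2 h3 h4 using ⟨h0, (h1.trans_le h3).le, (h2.trans_le h4).le⟩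
    refine wasserstein_le_of_tendsto (hpt t ht) (hpt s hs)
      (b := fun k => C * growthBound n (N k) C R' T * |t - s|) ?_ ?_
    · have := (hCg.comp hNmono.tendsto_atTop).mul_const |t - s|
      rwa [mul_comm (1 + R'), ← mul_assoc, add_comm 1 R'] at this
    · filter_upwards [hNmono.tendsto_atTop.eventually hev] with k ⟨h0, h1, h2⟩
      obtain ⟨P', Q', h⟩ := exists_isStepCurve hC hH1 hT.le hR'0 hae' h0 h1 h2
      rw [(hPQ (φ k)).coe_eq t ht, (hPQ (φ k)).coe_eq s hs, ← h.coe_eq t ht, ← h.coe_eq s hs]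
      exact h.wasserstein_le ht hs
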